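/- Let $f\in\mathbb C[x]$ be a monic polynomial of degree $5$ or $6$ with distinct roots, and let $X$ be the genus-two hyperelliptic curve $y^2=f(x)$, i.e. the compact Riemann surface obtained by gluing $C_0=\{y^2=f(x)\}$ and $C_0'=\{w^2=g(z)\}$, $g(z)=z^6f(1/z)$, along $(z,w)=(1/x,\,y/x^3)$, $x\neq 0$. Let $\iota$ be the hyperelliptic involution, $(x,y)\mapsto(x,-y)$, $(z,w)\mapsto(z,-w)$, and let $P_1,\dots,P_6$ be the Weierstrass points of $X$ (the points with $y=0$ or $w=0$). Equip $X$ with the canonical metric $ds^2=\omega_1\otimes\bar\omega_1+\omega_2\otimes\bar\omega_2$, where $\omega_1=dx/y$, $\omega_2=x\,dx/y$ (the pullback of the standard flat metric under the Abel–Jacobi map defined by $\omega_1,\omega_2$). Let $\Delta$ be its Laplace–Beltrami operator (equal to $\frac4\rho\frac{\partial^2}{\partial t\,\partial\bar t}$ where $ds^2=\rho\,dt\otimes d\bar t$) and $d\nu$ its area measure ($\rho\,|dt|^2$ in the same coordinate, $|dt|^2$ being Lebesgue measure). For $P\in C_0$ put $$F_P(Q)=\frac{|x(Q)-x(P)|}{\sqrt{1+|x(Q)|^2}}\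 (Q\in C_0),\qquad F_P(Q)=\frac{|1-z(Q)x(P)|}{\sqrt{1+|z(Q)|^2}}\ (Q\in C_0'),$$ and for $P\in X\setminus C_0$ put $F_P(Q)=1/\sqrt{1+|x(Q)|^2}$ for $Q\in C_0$ and $F_P(Q)=|z(Q)|/\sqrt{1+|z(Q)|^2}$ for $Q\in C_0'$. For a divisor $E=\sum n_PP$ put $F_E=\prod F_P^{n_P}$. **Theorem.** Let $Q_1,\dots,Q_s$ be distinct points of $X$, none of them a Weierstrass point, let $m_1,\dots,m_s$ be positive integers, and put $D=\sum_j m_jQ_j$, $W=\sum_{i=1}^6P_i$. Then the function $v=\log F_{W-D}$ is defined and smooth on $X\setminus\{P_1,\dots,P_6,Q_1,\dots,Q_s,\iota(Q_1),\dots,\iota(Q_s)\}$ and solves $$\Delta v+2\Big(6-\sum_{j=1}^sm_j\Big)F_D\,e^v=4\pi\sum_{i=1}^6\delta_{P_i}-2\pi\sum_{j=1}^sm_j\big(\delta_{Q_j}+\delta_{\iota(Q_j)}\big)$$ on $X$ in the sense of distributions: $v$ and $F_De^v$ are integrable with respect to $\nu$, and for every smooth $\varphi:X\to\mathbb R$,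 $$\int_Xv\,\Delta\varphi\,d\nu+2\Big(6-\sum_jm_j\Big)\int_XF_De^v\varphi\,d\nu=4\pi\sum_i\varphi(P_i)-2\pi\sum_jm_j\big(\varphi(Q_j)+\varphi(\iota(Q_j))\big).$$ -/

import Mathlib

open Polynomial MeasureTheory Set
open scoped ContDiff Manifold

noncomputable section

/-- The data of a complex hyperelliptic curve of genus two: a monic complex polynomial `f` of degree
five or six without multiple roots. The curve is the compactification of `y ^ 2 = f x`. -/
structure GenusTwoCurve where
  f : ℂ[X]
  monic : f.Monic
  natDegree_eq : f.natDegree = 5 ∨ f.natDegree = 6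
  squarefree : Squarefree f

/-- The affine plane curve `y ^ 2 = p x`, with the topology of a subset of `ℂ × ℂ`. -/
abbrev AffineCurve (p : ℂ[X]) : Type := {q : ℂ × ℂ // q.2 ^ 2 = p.eval q.1}

namespace AffineCurve

/-- A holomorphic coordinate chart of the affine curve: the chart map is one of the two coordinate
functions, and its inverse is a holomorphic map into `ℂ × ℂ`. -/
def IsCoordinateChart {p : ℂ[X]} (c : OpenPartialHomeomorph (AffineCurve p) ℂ) : Prop :=
  ((∀ q ∈ c.source, c q = q.1.1) ∨ (∀ q ∈ c.source, c q = q.1.2)) ∧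
    ContDiffOn ℂ ω (fun t => (c.symm t : ℂ × ℂ)) c.target

/-- The involution `(x, y) ↦ (x, -y)`. -/
def neg {p : ℂ[X]} (q : AffineCurve p) : AffineCurve p := ⟨(q.1.1, -q.1.2), by simpa using q.2⟩

theorem exists_local_inverse (P : ℂ → ℂ) (hP : ContDiff ℂ ω P) (a : ℂ) (ha : deriv P a ≠ 0) :
    ∃ e : OpenPartialHomeomorph ℂ ℂ, a ∈ e.source ∧ (∀ t, e t = P t) ∧
      ContDiffOn ℂ ω e.symm e.target := by
  have hd : ∀ t, HasDerivAt P (deriv P t) t := fun t =>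
    ((hP.differentiable (by simp)) t).hasDerivAt
  have hs : HasStrictDerivAt P (deriv P a) a :=
    hP.contDiffAt.hasStrictDerivAt' (hd a) (by simp)
  let e₀ := (hs.hasStrictFDerivAt_equiv ha).toOpenPartialHomeomorph P
  have hcoe : ∀ t, e₀ t = P t := fun t => rfl
  have hc : Continuous (deriv P) := hP.continuous_deriv (by simp)
  have ho : IsOpen {t | deriv P t ≠ 0} := isOpen_ne_fun hc continuous_const
  refine ⟨e₀.restrOpen _ ho, ?_, ?_, ?_⟩
  · exact ⟨(hs.hasStrictFDerivAt_equiv ha).mem_toOpenPartialHomeomorph_source, ha⟩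
  · intro t; rfl
  · intro t ht
    have hx := (e₀.restrOpen _ ho).map_target ht
    have h2 : ContDiffAt ℂ ω (e₀.restrOpen _ ho).symm t := by
      refine (e₀.restrOpen _ ho).contDiffAt_symm_deriv (f₀' := deriv P _) hx.2 ht ?_ ?_
      · exact hd _
      · exact hP.contDiffAt
    exact h2.contDiffWithinAt

/-- On a nonsingular affine curve the coordinate charts cover. -/
theorem exists_coordinateChart {p : ℂ[X]}
    (hp : ∀ a, p.eval a = 0 → p.derivative.eval a ≠ 0) (q : AffineCurve p) :
    ∃ c : OpenPartialHomeomorph (AffineCurve p) ℂ, q ∈ c.source ∧ IsCoordinateChart c := by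
  have hpc : Continuous fun t => p.eval t := p.continuous
  have hpω : ContDiff ℂ ω fun t => p.eval t := by simpa using p.contDiff_aeval (𝕜 := ℂ) ω
  by_cases hq : q.1.2 = 0
  · obtain ⟨e, hae, he, hes⟩ := exists_local_inverse (fun t => p.eval t) hpω q.1.1 (by
      rw [Polynomial.deriv]
      apply hp
      rw [← q.2, hq]; simp)
    have ht : ∀ t ∈ (fun t : ℂ => t ^ 2) ⁻¹' e.target, t ^ 2 = p.eval (e.symm (t ^ 2)) := by
      intro t ht
      rw [← he, e.right_inv ht]
    have hcont : ContinuousOn (fun t : ℂ => (e.symm (t ^ 2), t))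
        ((fun t : ℂ => t ^ 2) ⁻¹' e.target) :=
      (e.continuousOn_symm.comp (f := fun t : ℂ => t ^ 2) (by fun_prop) (fun t ht => ht)).prodMk
        continuousOn_id
    classical
    let c : OpenPartialHomeomorph (AffineCurve p) ℂ :=
      { toFun := fun q => q.1.2
        invFun := fun t => if h : t ^ 2 = p.eval (e.symm (t ^ 2)) then ⟨(e.symm (t ^ 2), t), h⟩
          else q
        source := {q | q.1.1 ∈ e.source}
        target := (fun t : ℂ => t ^ 2) ⁻¹' e.target
        map_source' := by
          intro q hq
          have := e.map_source hq
          rw [he, ← q.2] at this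
          exact this
        map_target' := by
          intro t h
          simp only [dif_pos (ht t h)]
          exact e.map_target h
        left_inv' := by
          intro q hq
          have h1 : e.symm (q.1.2 ^ 2) = q.1.1 := by
            rw [q.2, ← he, e.left_inv hq]
          have h2 : q.1.2 ^ 2 = p.eval (e.symm (q.1.2 ^ 2)) := by rw [h1]; exact q.2
          rw [dif_pos h2]
          apply Subtype.ext
          simp only [h1]
        right_inv' := by
          intro t h
          simp only [dif_pos (ht t h)]
        open_source := e.open_source.preimage (by fun_prop)
        open_target := e.open_target.preimage (by fun_prop)
        continuousOn_toFun := by fun_prop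
        continuousOn_invFun := by
          refine Topology.IsInducing.subtypeVal.continuousOn_iff.2 ?_
          refine hcont.congr ?_
          intro t h
          simp only [Function.comp, dif_pos (ht t h)] }
    refine ⟨c, hae, Or.inr fun _ _ => rfl, ?_⟩
    have : ContDiffOn ℂ ω (fun t : ℂ => (e.symm (t ^ 2), t)) c.target :=
      (hes.comp (f := fun t : ℂ => t ^ 2) (by fun_prop) (fun t ht => ht)).prodMk contDiffOn_id
    refine this.congr ?_
    intro t h
    change ((if h : t ^ 2 = p.eval (e.symm (t ^ 2)) then ⟨(e.symm (t ^ 2), t), h⟩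
          else q : AffineCurve p) : ℂ × ℂ) = _
    rw [dif_pos (ht t h)]
  · obtain ⟨e, hae, he, hes⟩ := exists_local_inverse (fun t : ℂ => t ^ 2) (by fun_prop) q.1.2 (by
      simpa using hq)
    have ht : ∀ t ∈ (fun t : ℂ => p.eval t) ⁻¹' e.target, (e.symm (p.eval t)) ^ 2 = p.eval t := by
      intro t ht
      have := e.right_inv ht
      rwa [he] at this
    have hcont : ContinuousOn (fun t : ℂ => (t, e.symm (p.eval t)))
        ((fun t : ℂ => p.eval t) ⁻¹' e.target) :=
      continuousOn_id.prodMk (e.continuousOn_symm.comp hpc.continuousOn (fun t ht => ht))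
    classical
    let c : OpenPartialHomeomorph (AffineCurve p) ℂ :=
      { toFun := fun q => q.1.1
        invFun := fun t => if h : (e.symm (p.eval t)) ^ 2 = p.eval t then
          ⟨(t, e.symm (p.eval t)), h⟩ else q
        source := {q | q.1.2 ∈ e.source}
        target := (fun t : ℂ => p.eval t) ⁻¹' e.target
        map_source' := by
          intro q hq
          have := e.map_source hq
          rw [he, q.2] at this
          exact this
        map_target' := by
          intro t h
          simp only [dif_pos (ht t h)]
          exact e.map_target h
        left_inv' := by
          intro q hq
          have h1 : e.symm (p.eval q.1.1) = q.1.2 := by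
            rw [← q.2, ← he, e.left_inv hq]
          have h2 : (e.symm (p.eval q.1.1)) ^ 2 = p.eval q.1.1 := by rw [h1]; exact q.2
          rw [dif_pos h2]
          apply Subtype.ext
          simp only [h1]
        right_inv' := by
          intro t h
          simp only [dif_pos (ht t h)]
        open_source := e.open_source.preimage (by fun_prop)
        open_target := e.open_target.preimage hpc
        continuousOn_toFun := by fun_prop
        continuousOn_invFun := by
          refine Topology.IsInducing.subtypeVal.continuousOn_iff.2 ?_
          refine hcont.congr ?_
          intro t h
          simp only [Function.comp, dif_pos (ht t h)] }
    refine ⟨c, hae, Or.inl fun _ _ => rfl, ?_⟩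
    have : ContDiffOn ℂ ω (fun t : ℂ => (t, e.symm (p.eval t))) c.target :=
      contDiffOn_id.prodMk (hes.comp hpω.contDiffOn (fun t ht => ht))
    refine this.congr ?_
    intro t h
    change ((if h : (e.symm (p.eval t)) ^ 2 = p.eval t then
          ⟨(t, e.symm (p.eval t)), h⟩ else q : AffineCurve p) : ℂ × ℂ) = _
    rw [dif_pos (ht t h)]

end AffineCurve

namespace GenusTwoCurve

variable (C : GenusTwoCurve)

/-- The polynomial `g z = z ^ 6 * f (1 / z)`. -/
def g : ℂ[X] := C.f.reflect 6

theorem natDegree_le : C.f.natDegree ≤ 6 := by rcases C.natDegree_eq with h | h <;> omega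

theorem g_eval (x : ℂ) (hx : x ≠ 0) : C.g.eval x⁻¹ = C.f.eval x / x ^ 6 := by
  have := invertibleOfNonzero hx
  have h := eval₂_reflect_mul_pow (RingHom.id ℂ) x 6 C.f C.natDegree_le
  rw [invOf_eq_inv] at h
  rw [eq_div_iff (pow_ne_zero _ hx)]
  exact h

theorem f_eval (z : ℂ) (hz : z ≠ 0) : C.f.eval z⁻¹ = C.g.eval z / z ^ 6 := by
  have h := C.g_eval z⁻¹ (inv_ne_zero hz)
  rw [inv_inv] at h
  rw [h]; field_simp

theorem f_nonsingular (a : ℂ) (ha : C.f.eval a = 0) : C.f.derivative.eval a ≠ 0 := by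
  have hs : C.f.Separable := PerfectField.separable_iff_squarefree.2 C.squarefree
  obtain ⟨u, v, h⟩ := hs
  intro h'
  have := congrArg (eval a) h
  simp [ha, h'] at this

theorem g_nonsingular (a : ℂ) (ha : C.g.eval a = 0) : C.g.derivative.eval a ≠ 0 := by
  by_cases h0 : a = 0
  · subst h0
    have h6 : C.f.coeff 6 = 0 := by
      have := ha
      rw [← coeff_zero_eq_eval_zero, g, coeff_reflect] at this
      simpa using this
    have h5 : C.f.natDegree = 5 := by
      rcases C.natDegree_eq with h | h
      · exact h
      · have := C.monic.coeff_natDegree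
        rw [h, h6] at this
        simp at this
    have := C.monic.coeff_natDegree
    rw [h5] at this
    rw [← coeff_zero_eq_eval_zero, coeff_derivative, g, coeff_reflect]
    have h1 : revAt 6 1 = 5 := by rw [revAt_le (by norm_num)]
    simp [h1, this]
  · have hf0 : C.f.eval a⁻¹ = 0 := by rw [C.f_eval a h0, ha]; simp
    have hf1 := C.f_nonsingular _ hf0
    intro hg
    apply hf1
    have e1 : HasDerivAt (fun t => C.f.eval t⁻¹) (C.f.derivative.eval a⁻¹ * (-(a ^ 2)⁻¹)) a :=
      (C.f.hasDerivAt a⁻¹).comp a (hasDerivAt_inv h0)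
    have e2 : HasDerivAt (fun t => C.g.eval t / t ^ 6)
        ((C.g.derivative.eval a * a ^ 6 - C.g.eval a * (6 * a ^ 5)) / (a ^ 6) ^ 2) a := by
      have := (C.g.hasDerivAt a).fun_div (hasDerivAt_pow 6 a) (pow_ne_zero _ h0)
      simpa only [Nat.cast_ofNat, Nat.reduceSub] using this
    have e3 : (fun t => C.f.eval t⁻¹) =ᶠ[nhds a] fun t => C.g.eval t / t ^ 6 := by
      filter_upwards [isOpen_ne.mem_nhds h0] with t ht using C.f_eval t ht
    have := e1.unique (e2.congr_of_eventuallyEq e3)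
    rw [ha, hg] at this
    simpa [h0] using this

/-- The affine curve `C₀ : y ^ 2 = f x`. -/
abbrev C₀ : Type := AffineCurve C.f

/-- The affine curve `C₀' : w ^ 2 = g z`. -/
abbrev C₁ : Type := AffineCurve C.g

/-- The gluing relation: `(x, y)` with `x ≠ 0` is identified with `(1 / x, y / x ^ 3)`. -/
def Glue : C.C₀ ⊕ C.C₁ → C.C₀ ⊕ C.C₁ → Prop
  | Sum.inl a, Sum.inl a' => a = a'
  | Sum.inr b, Sum.inr b' => b = b'
  | Sum.inl a, Sum.inr b => a.1.1 ≠ 0 ∧ b.1.1 = a.1.1⁻¹ ∧ b.1.2 = a.1.2 / a.1.1 ^ 3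
  | Sum.inr b, Sum.inl a => a.1.1 ≠ 0 ∧ b.1.1 = a.1.1⁻¹ ∧ b.1.2 = a.1.2 / a.1.1 ^ 3

theorem glue_equivalence : Equivalence C.Glue where
  refl := by rintro (a | b) <;> simp [Glue]
  symm := by
    rintro (a | b) (a' | b') h
    · exact Eq.symm h
    · exact h
    · exact h
    · exact Eq.symm h
  trans := by
    rintro (a | b) (a' | b') (a'' | b'') h h'
    · exact Eq.trans h h'
    · obtain rfl : a = a' := h
      exact h'
    · obtain ⟨h1, h2, h3⟩ := h
      obtain ⟨h1', h2', h3'⟩ := h'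
      have e1 : a.1.1 = a''.1.1 := by rw [h2] at h2'; exact inv_injective h2'
      refine Subtype.ext (Prod.ext e1 ?_)
      rw [h3, e1] at h3'
      exact (div_left_inj' (pow_ne_zero _ h1')).1 h3'
    · obtain rfl : b' = b'' := h'
      exact h
    · obtain rfl : a' = a'' := h'
      exact h
    · obtain ⟨h1, h2, h3⟩ := h
      obtain ⟨h1', h2', h3'⟩ := h'
      exact Subtype.ext (Prod.ext (h2.trans h2'.symm) (h3.trans h3'.symm))
    · obtain rfl : b = b' := h
      exact h'
    · exact Eq.trans h h'

instance glueSetoid : Setoid (C.C₀ ⊕ C.C₁) := ⟨C.Glue, C.glue_equivalence⟩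

/-- The compact curve: the gluing of `C₀` and `C₀'`, with the quotient topology. -/
def Pt : Type := Quotient C.glueSetoid

instance : TopologicalSpace C.Pt := inferInstanceAs (TopologicalSpace (Quotient C.glueSetoid))

/-- The inclusion of `C₀` into the curve. -/
def inc₀ (a : C.C₀) : C.Pt := Quotient.mk C.glueSetoid (Sum.inl a)

/-- The inclusion of `C₀'` into the curve. -/
def inc₁ (b : C.C₁) : C.Pt := Quotient.mk C.glueSetoid (Sum.inr b)

theorem inc₀_eq_inc₁ (a : C.C₀) (b : C.C₁) : C.inc₀ a = C.inc₁ b ↔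
    a.1.1 ≠ 0 ∧ b.1.1 = a.1.1⁻¹ ∧ b.1.2 = a.1.2 / a.1.1 ^ 3 :=
  ⟨fun h => Quotient.exact h, fun h => Quotient.sound h⟩

theorem isOpenEmbedding_inc₀ : Topology.IsOpenEmbedding C.inc₀ := by
  refine Topology.IsOpenEmbedding.of_continuous_injective_isOpenMap
    (continuous_quotient_mk'.comp continuous_inl) (fun a a' h => Quotient.exact h) ?_
  rintro _ ⟨V, hV, rfl⟩
  change IsOpen ((Quotient.mk C.glueSetoid) ⁻¹' _)
  rw [isOpen_sum_iff]
  constructor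
  · convert hV.preimage continuous_subtype_val using 1
    ext a
    constructor
    · rintro ⟨a', h', h⟩
      obtain rfl : a' = a := Quotient.exact h
      exact h'
    · intro h
      exact ⟨a, h, rfl⟩
  · have ho : IsOpen ({b : C.C₁ | b.1.1 ≠ 0} ∩
        (fun b : C.C₁ => (b.1.1⁻¹, b.1.2 / b.1.1 ^ 3)) ⁻¹' V) := by
      refine ContinuousOn.isOpen_inter_preimage ?_ (isOpen_ne_fun (by fun_prop) (by fun_prop)) hV
      refine ContinuousOn.prodMk (ContinuousOn.inv₀ (by fun_prop) fun b hb => hb) ?_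
      exact ContinuousOn.div (by fun_prop) (by fun_prop) fun b hb => pow_ne_zero _ hb
    convert ho using 1
    ext b
    constructor
    · rintro ⟨a, ha, h⟩
      obtain ⟨h1, h2, h3⟩ := (C.inc₀_eq_inc₁ a b).1 h
      refine ⟨by simpa [h2] using h1, ?_⟩
      have : (b.1.1⁻¹, b.1.2 / b.1.1 ^ 3) = a.1 := by
        refine Prod.ext (by simp [h2]) ?_
        simp only [h2, h3]
        field_simp
      change (b.1.1⁻¹, b.1.2 / b.1.1 ^ 3) ∈ V
      rw [this]; exact ha
    · rintro ⟨h0, hb⟩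
      have h0' : b.1.1 ≠ 0 := h0
      refine ⟨⟨(b.1.1⁻¹, b.1.2 / b.1.1 ^ 3), ?_⟩, hb, ?_⟩
      · change (b.1.2 / b.1.1 ^ 3) ^ 2 = C.f.eval b.1.1⁻¹
        rw [C.f_eval _ h0', ← b.2]; field_simp
      · refine (C.inc₀_eq_inc₁ _ b).2 ⟨inv_ne_zero h0', by simp, ?_⟩
        simp only
        field_simp

theorem isOpenEmbedding_inc₁ : Topology.IsOpenEmbedding C.inc₁ := by
  refine Topology.IsOpenEmbedding.of_continuous_injective_isOpenMap
    (continuous_quotient_mk'.comp continuous_inr) (fun a a' h => Quotient.exact h) ?_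
  rintro _ ⟨V, hV, rfl⟩
  change IsOpen ((Quotient.mk C.glueSetoid) ⁻¹' _)
  rw [isOpen_sum_iff, and_comm]
  constructor
  · convert hV.preimage continuous_subtype_val using 1
    ext a
    constructor
    · rintro ⟨a', h', h⟩
      obtain rfl : a' = a := Quotient.exact h
      exact h'
    · intro h
      exact ⟨a, h, rfl⟩
  · have ho : IsOpen ({a : C.C₀ | a.1.1 ≠ 0} ∩
        (fun a : C.C₀ => (a.1.1⁻¹, a.1.2 / a.1.1 ^ 3)) ⁻¹' V) := by
      refine ContinuousOn.isOpen_inter_preimage ?_ (isOpen_ne_fun (by fun_prop) (by fun_prop)) hV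
      refine ContinuousOn.prodMk (ContinuousOn.inv₀ (by fun_prop) fun b hb => hb) ?_
      exact ContinuousOn.div (by fun_prop) (by fun_prop) fun b hb => pow_ne_zero _ hb
    convert ho using 1
    ext a
    constructor
    · rintro ⟨b, hb, h⟩
      obtain ⟨h1, h2, h3⟩ := (C.inc₀_eq_inc₁ a b).1 h.symm
      refine ⟨h1, ?_⟩
      have : (a.1.1⁻¹, a.1.2 / a.1.1 ^ 3) = b.1 := Prod.ext h2.symm h3.symm
      change (a.1.1⁻¹, a.1.2 / a.1.1 ^ 3) ∈ V
      rw [this]; exact hb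
    · rintro ⟨h0, ha⟩
      have h0' : a.1.1 ≠ 0 := h0
      refine ⟨⟨(a.1.1⁻¹, a.1.2 / a.1.1 ^ 3), ?_⟩, ha, ?_⟩
      · change (a.1.2 / a.1.1 ^ 3) ^ 2 = C.g.eval a.1.1⁻¹
        rw [C.g_eval _ h0', ← a.2]; field_simp
      · exact ((C.inc₀_eq_inc₁ a _).2 ⟨h0', rfl, rfl⟩).symm

/-- The charts of the curve: coordinate charts of `C₀` and of `C₀'`. -/
def charts : Set (OpenPartialHomeomorph C.Pt ℂ) :=
  {e | (∃ c : OpenPartialHomeomorph C.C₀ ℂ, AffineCurve.IsCoordinateChart c ∧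
      e = c.lift_openEmbedding C.isOpenEmbedding_inc₀) ∨
    (∃ c : OpenPartialHomeomorph C.C₁ ℂ, AffineCurve.IsCoordinateChart c ∧
      e = c.lift_openEmbedding C.isOpenEmbedding_inc₁)}

theorem exists_chart (P : C.Pt) : ∃ e ∈ C.charts, P ∈ e.source := by
  induction P using Quotient.inductionOn with
  | h s =>
    rcases s with a | b
    · obtain ⟨c, hc, h⟩ := AffineCurve.exists_coordinateChart C.f_nonsingular a
      exact ⟨_, Or.inl ⟨c, h, rfl⟩, ⟨a, hc, rfl⟩⟩
    · obtain ⟨c, hc, h⟩ := AffineCurve.exists_coordinateChart C.g_nonsingular b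
      exact ⟨_, Or.inr ⟨c, h, rfl⟩, ⟨b, hc, rfl⟩⟩

instance : ChartedSpace ℂ C.Pt where
  atlas := C.charts
  chartAt P := (C.exists_chart P).choose
  mem_chart_source P := (C.exists_chart P).choose_spec.2
  chart_mem_atlas P := (C.exists_chart P).choose_spec.1

theorem charts_compatible {e e' : OpenPartialHomeomorph C.Pt ℂ} (he : e ∈ C.charts)
    (he' : e' ∈ C.charts) : ContDiffOn ℂ ω (e.symm ≫ₕ e') (e.symm ≫ₕ e').source := by
  rcases he with ⟨c, hc, rfl⟩ | ⟨c, hc, rfl⟩ <;> rcases he' with ⟨c', hc', rfl⟩ | ⟨c', hc', rfl⟩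
  · rw [OpenPartialHomeomorph.lift_openEmbedding_trans]
    have h := hc.2.mono (inter_subset_left : (c.symm ≫ₕ c').source ⊆ c.target)
    rcases hc'.1 with h' | h'
    · exact h.fst.congr fun t ht => h' _ ht.2
    · exact h.snd.congr fun t ht => h' _ ht.2
  · set e := c.lift_openEmbedding C.isOpenEmbedding_inc₀
    set e' := c'.lift_openEmbedding C.isOpenEmbedding_inc₁
    have key : ∀ t ∈ (e.symm ≫ₕ e').source, ∃ b ∈ c'.source, (e.symm ≫ₕ e') t = c' b ∧
        (c.symm t).1.1 ≠ 0 ∧ b.1.1 = (c.symm t).1.1⁻¹ ∧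
        b.1.2 = (c.symm t).1.2 / (c.symm t).1.1 ^ 3 := by
      rintro t ⟨ht, b, hb, hbt⟩
      refine ⟨b, hb, ?_, (C.inc₀_eq_inc₁ _ b).1 hbt.symm⟩
      change e' (C.inc₀ (c.symm t)) = _
      rw [show C.inc₀ (c.symm t) = C.inc₁ b from hbt.symm]
      exact c'.lift_openEmbedding_apply _
    have h : ContDiffOn ℂ ω (fun t => (c.symm t : ℂ × ℂ)) (e.symm ≫ₕ e').source :=
      hc.2.mono inter_subset_left
    have h0 : ∀ t ∈ (e.symm ≫ₕ e').source, (c.symm t).1.1 ≠ 0 := fun t ht => by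
      obtain ⟨b, -, -, hx, -⟩ := key t ht
      exact hx
    rcases hc'.1 with h' | h'
    · refine (h.fst.inv h0).congr fun t ht => ?_
      obtain ⟨b, hb, hbt, -, hz, -⟩ := key t ht
      rw [hbt, h' b hb, hz]; rfl
    · refine (h.snd.div (h.fst.pow 3) fun t ht => pow_ne_zero _ (h0 t ht)).congr fun t ht => ?_
      obtain ⟨b, hb, hbt, -, -, hw⟩ := key t ht
      rw [hbt, h' b hb, hw]; rfl
  · set e := c.lift_openEmbedding C.isOpenEmbedding_inc₁
    set e' := c'.lift_openEmbedding C.isOpenEmbedding_inc₀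
    have key : ∀ t ∈ (e.symm ≫ₕ e').source, ∃ a ∈ c'.source, (e.symm ≫ₕ e') t = c' a ∧
        (c.symm t).1.1 ≠ 0 ∧ a.1.1 = (c.symm t).1.1⁻¹ ∧
        a.1.2 = (c.symm t).1.2 / (c.symm t).1.1 ^ 3 := by
      rintro t ⟨ht, a, ha, hat⟩
      obtain ⟨h1, h2, h3⟩ := (C.inc₀_eq_inc₁ a (c.symm t)).1 hat
      refine ⟨a, ha, ?_, by simpa [h2] using h1, by simp [h2], ?_⟩
      · change e' (C.inc₁ (c.symm t)) = _
        rw [show C.inc₁ (c.symm t) = C.inc₀ a from hat.symm]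
        exact c'.lift_openEmbedding_apply _
      · rw [h2, h3]
        field_simp
    have h : ContDiffOn ℂ ω (fun t => (c.symm t : ℂ × ℂ)) (e.symm ≫ₕ e').source :=
      hc.2.mono inter_subset_left
    have h0 : ∀ t ∈ (e.symm ≫ₕ e').source, (c.symm t).1.1 ≠ 0 := fun t ht => by
      obtain ⟨b, -, -, hx, -⟩ := key t ht
      exact hx
    rcases hc'.1 with h' | h'
    · refine (h.fst.inv h0).congr fun t ht => ?_
      obtain ⟨b, hb, hbt, -, hz, -⟩ := key t ht
      rw [hbt, h' b hb, hz]; rfl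
    · refine (h.snd.div (h.fst.pow 3) fun t ht => pow_ne_zero _ (h0 t ht)).congr fun t ht => ?_
      obtain ⟨b, hb, hbt, -, -, hw⟩ := key t ht
      rw [hbt, h' b hb, hw]; rfl
  · rw [OpenPartialHomeomorph.lift_openEmbedding_trans]
    have h := hc.2.mono (inter_subset_left : (c.symm ≫ₕ c').source ⊆ c.target)
    rcases hc'.1 with h' | h'
    · exact h.fst.congr fun t ht => h' _ ht.2
    · exact h.snd.congr fun t ht => h' _ ht.2

instance : IsManifold 𝓘(ℂ) ω C.Pt := by
  refine isManifold_of_contDiffOn _ _ _ fun e e' he he' => ?_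
  simpa using C.charts_compatible he he'

instance : IsManifold 𝓘(ℝ, ℂ) ∞ C.Pt := by
  refine isManifold_of_contDiffOn _ _ _ fun e e' he he' => ?_
  simpa using ((C.charts_compatible he he').restrict_scalars ℝ).of_le le_top

/-- The affine coordinates `(x, y)`; meaningful at the points of `C₀`. -/
def coords₀ : C.Pt → ℂ × ℂ :=
  Quotient.lift (Sum.elim (fun a => a.1) fun b => (b.1.1⁻¹, b.1.2 / b.1.1 ^ 3)) (by
    rintro (a | b) (a' | b') h
    · exact congrArg Subtype.val h
    · obtain ⟨h1, h2, h3⟩ := h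
      refine Prod.ext (by simp [h2]) ?_
      simp only [Sum.elim_inl, Sum.elim_inr, h2, h3]
      field_simp
    · obtain ⟨h1, h2, h3⟩ := h
      refine Prod.ext (by simp [h2]) ?_
      simp only [Sum.elim_inl, Sum.elim_inr, h2, h3]
      field_simp
    · rw [show b = b' from h])

/-- The affine coordinates `(z, w)`; meaningful at the points of `C₀'`. -/
def coords₁ : C.Pt → ℂ × ℂ :=
  Quotient.lift (Sum.elim (fun a => (a.1.1⁻¹, a.1.2 / a.1.1 ^ 3)) fun b => b.1) (by
    rintro (a | b) (a' | b') h
    · rw [show a = a' from h]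
    · obtain ⟨h1, h2, h3⟩ := h
      exact (Prod.ext h2 h3).symm
    · obtain ⟨h1, h2, h3⟩ := h
      exact Prod.ext h2 h3
    · exact congrArg Subtype.val h)

/-- The coordinate `x` on `C₀`. -/
def x (P : C.Pt) : ℂ := (C.coords₀ P).1

/-- The coordinate `z` on `C₀'`. -/
def z (P : C.Pt) : ℂ := (C.coords₁ P).1

/-- The hyperelliptic involution, `(x, y) ↦ (x, -y)` on `C₀` and `(z, w) ↦ (z, -w)` on `C₀'`. -/
def involution : C.Pt → C.Pt :=
  Quotient.map (Sum.map AffineCurve.neg AffineCurve.neg) (by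
    rintro (a | b) (a' | b') h
    · exact congrArg AffineCurve.neg h
    · obtain ⟨h1, h2, h3⟩ := h
      exact ⟨h1, h2, by simp [AffineCurve.neg, h3, neg_div]⟩
    · obtain ⟨h1, h2, h3⟩ := h
      exact ⟨h1, h2, by simp [AffineCurve.neg, h3, neg_div]⟩
    · exact congrArg AffineCurve.neg h)

/-- The Weierstrass points: the branch points of the double covering of the projective line, that
is, the points `(e, 0)` of `C₀` or of `C₀'`. -/
def weierstrassPoints : Set C.Pt :=
  {P | (∃ a : C.C₀, a.1.2 = 0 ∧ C.inc₀ a = P) ∨ (∃ b : C.C₁, b.1.2 = 0 ∧ C.inc₁ b = P)}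

/-- The Weierstrass points are the fixed points of the involution. -/
theorem involution_eq_self_iff (P : C.Pt) : C.involution P = P ↔ P ∈ C.weierstrassPoints := by
  have hneg : ∀ y : ℂ, -y = y → y = 0 := fun y h => self_eq_neg.1 h.symm
  constructor
  · induction P using Quotient.inductionOn with
    | h s =>
      intro h
      rcases s with a | b
      · have h' : AffineCurve.neg a = a := Quotient.exact h
        exact Or.inl ⟨a, hneg _ (congrArg (fun q : C.C₀ => q.1.2) h'), rfl⟩
      · have h' : AffineCurve.neg b = b := Quotient.exact h
        exact Or.inr ⟨b, hneg _ (congrArg (fun q : C.C₁ => q.1.2) h'), rfl⟩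
  · rintro (⟨a, ha, rfl⟩ | ⟨b, hb, rfl⟩)
    · exact congrArg C.inc₀ (Subtype.ext (Prod.ext rfl (by simp [AffineCurve.neg, ha])))
    · exact congrArg C.inc₁ (Subtype.ext (Prod.ext rfl (by simp [AffineCurve.neg, hb])))

/-- For a parametrization `γ = (a, b)` of the affine curve `b ^ 2 = p a`, the coefficient `h` in
`da / b = h dt`. Where `b = 0` it is computed from `2 b db = p' a da`, that is,
`da / b = 2 db / p' a`. -/
def formCoeff (p : ℂ[X]) (γ : ℂ → ℂ × ℂ) (t : ℂ) : ℂ :=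
  open Classical in
  if (γ t).2 ≠ 0 then deriv (fun s => (γ s).1) t / (γ t).2
  else 2 * deriv (fun s => (γ s).2) t / p.derivative.eval (γ t).1

/-- The coefficients, in the chart `e` with coordinate `t`, of the holomorphic one-forms `dx / y` and
`x dx / y`, which form a basis of the holomorphic one-forms. On `C₀'` these are `-z dz / w` and
`-dz / w`. -/
def holForm (e : OpenPartialHomeomorph C.Pt ℂ) (t : ℂ) : Fin 2 → ℂ :=
  open Classical in
  if e.symm t ∈ range C.inc₀ then
    ![formCoeff C.f (fun s => C.coords₀ (e.symm s)) t,
      C.x (e.symm t) * formCoeff C.f (fun s => C.coords₀ (e.symm s)) t]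
  else
    ![-C.z (e.symm t) * formCoeff C.g (fun s => C.coords₁ (e.symm s)) t,
      -formCoeff C.g (fun s => C.coords₁ (e.symm s)) t]

/-- The conformal factor `ρ` of the canonical metric `ds² = ρ dt ⊗ dt̄` in the chart `e`. The canonical
metric is the pullback of the flat metric `∑ dzᵢ ⊗ dz̄ᵢ` of the Jacobian under the Abel-Jacobi map
`P ↦ (∫ ω₁, ∫ ω₂)`, i.e. it is `∑ ωᵢ ⊗ ω̄ᵢ` where `ω₁ = dx / y` and `ω₂ = x dx / y`. -/
def conformalFactor (e : OpenPartialHomeomorph C.Pt ℂ) (t : ℂ) : ℝ := ∑ i, ‖C.holForm e t i‖ ^ 2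

/-- The Laplace-Beltrami operator of the canonical metric: in a holomorphic chart, `ρ⁻¹` times the
Laplacian of the plane. -/
def laplacian (φ : C.Pt → ℝ) (P : C.Pt) : ℝ :=
  (C.conformalFactor (chartAt ℂ P) (chartAt ℂ P P))⁻¹ *
    (Laplacian.laplacian (fun t => φ ((chartAt ℂ P).symm t)) : ℂ → ℝ) (chartAt ℂ P P)

instance : MeasurableSpace C.Pt := borel C.Pt

instance : BorelSpace C.Pt := ⟨rfl⟩

/-- The area measure of the canonical metric. Every chart `e` carries the measure `ρ` times Lebesgue
measure; these agree on overlaps, and the area measure, which restricts to each of them, is their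
supremum. -/
def area : Measure C.Pt :=
  ⨆ e ∈ atlas ℂ C.Pt, Measure.map e.symm
    ((volume.restrict e.target).withDensity fun t => ENNReal.ofReal (C.conformalFactor e t))

/-- The function `F_P` of a point `P`. -/
def F (P Q : C.Pt) : ℝ :=
  open Classical in
  if P ∈ range C.inc₀ then
    if Q ∈ range C.inc₀ then ‖C.x Q - C.x P‖ / √(1 + ‖C.x Q‖ ^ 2)
    else ‖1 - C.z Q * C.x P‖ / √(1 + ‖C.z Q‖ ^ 2)
  else
    if Q ∈ range C.inc₀ then 1 / √(1 + ‖C.x Q‖ ^ 2)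
    else ‖C.z Q‖ / √(1 + ‖C.z Q‖ ^ 2)

/-- Divisors on the curve. -/
abbrev Divisor : Type := C.Pt →₀ ℤ

/-- The function `F_D = ∏ F_P ^ n_P` of a divisor `D = ∑ n_P P`. -/
def FD (D : C.Divisor) (Q : C.Pt) : ℝ := D.prod fun P n => C.F P Q ^ n

/-- The Dirac distribution `φ ↦ φ P`. -/
def dirac (P : C.Pt) : (C.Pt → ℝ) → ℝ := fun φ => φ P

/-- `v` solves `Δ v + ρ h e ^ v = T` in the sense of distributions, with respect to the canonical
metric; `v` and `h e ^ v` need only be defined almost everywhere. -/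
def IsSolution (ρ : ℝ) (h : C.Pt → ℝ) (T : (C.Pt → ℝ) → ℝ) (v : C.Pt → ℝ) : Prop :=
  Integrable v C.area ∧ Integrable (fun Q => h Q * Real.exp (v Q)) C.area ∧
    ∀ φ : C.Pt → ℝ, ContMDiff 𝓘(ℝ, ℂ) 𝓘(ℝ, ℝ) ∞ φ →
      ∫ Q, v Q * C.laplacian φ Q ∂C.area + ρ * ∫ Q, h Q * Real.exp (v Q) * φ Q ∂C.area = T φ

end GenusTwoCurve

end

noncomputable section

/-! ### The Laplacian of the plane under holomorphic maps -/

section PlaneLaplacian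

open Laplacian InnerProductSpace Filter Topology

/-! The equation becomes linear after taking logarithms. On either affine piece, with `a` the
coordinate `x` or `z`, every `F_R` has the form `|l a + m| / √(1 + |a|²)`. Hence `log F_R = log |l a
+ m| - ½ log (1 + |a|²)`. The first term is harmonic away from the zeros of `l a + m`. The second
contributes `-2 |a'|² / (1 + |a|²)²` to the plane Laplacian, a pullback of the spherical density
that does not depend on `R`.

The product over the branch points turns this density into an intrinsic function. The six linear
factors multiply to `f x` (or `g z`), so `∏ F_{P_i} = |b|² / (1 + |a|²)³`, where `b` is `y` or `w`.
The conformal factor is `ρ = |a'/b|² (1 + |a|²)`, read by continuity where `b = 0`, so `ρ ∏ F_{P_i}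
= |a'|² / (1 + |a|²)²` (`LocalModel.prod_F_mul_conformalFactor`). Off its zeros, therefore, `Δ log
F_R = -2 ∏ F_{P_i}` for every `R`.

The point masses come from the zeros of `l a + m`: simple at `R` and at its conjugate if these
differ, double if `R` is a Weierstrass point (`LocalModel.exists_factorization`). Since `log |t|` is
`2π` times a fundamental solution (`integral_log_norm_mul_laplacian`), a partition of unity gives `Δ
log F_R = 2π (δ_R + δ_{ιR}) - 2 ∏ F_{P_i}` on the whole curve (`integral_log_F_mul_laplacian`).

Now `v = ∑ log F_{P_i} - ∑ m_j log F_{Q_j}` and `F_D e^v = F_W = ∏ F_{P_i}` almost everywhere.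
Adding the linear equations yields the coefficient `-2 (6 - ∑ m_j)` of `F_D e^v`, and `ι P_i = P_i`
turns `2π` into `4π`.

To pass between charts and the curve, the plane Laplacian and Lebesgue measure pick up the factor
`|τ'|²` under a transition `τ`, as does `ρ`. The supremum defining the area measure then restricts
to the measure of each chart (`area_restrict_source`). -/

theorem laplacian_eq_fderiv_fderiv (f : ℂ → ℝ) (z : ℂ) :
    (Δ f) z = fderiv ℝ (fderiv ℝ f) z 1 1 +
      fderiv ℝ (fderiv ℝ f) z Complex.I Complex.I := by
  rw [laplacian_eq_iteratedFDeriv_complexPlane]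
  simp [iteratedFDeriv_two_apply]

theorem fderiv_fderiv_apply {f : ℂ → ℝ} {z : ℂ} (hf : ContDiffAt ℝ 2 f z) (v : ℂ) :
    fderiv ℝ (fun w => fderiv ℝ f w v) z v = fderiv ℝ (fderiv ℝ f) z v v := by
  have h : DifferentiableAt ℝ (fderiv ℝ f) z :=
    (hf.fderiv_right (m := 1) (by norm_num)).differentiableAt (by norm_num)
  rw [fderiv_clm_apply h (differentiableAt_const v)]
  simp

theorem fderiv_real_apply {τ : ℂ → ℂ} {w : ℂ} (hτ : DifferentiableAt ℂ τ w) (v : ℂ) :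
    fderiv ℝ τ w v = deriv τ w * v := by
  rw [hτ.fderiv_restrictScalars ℝ]
  simp [mul_comm]

/-- The Laplacian of the plane is conformally covariant under holomorphic maps. -/
theorem laplacian_comp_analytic {ψ : ℂ → ℝ} {τ : ℂ → ℂ} {t : ℂ} (hτ : AnalyticAt ℂ τ t)
    (hψ : ContDiffAt ℝ 2 ψ (τ t)) :
    (Δ (fun s => ψ (τ s))) t = ‖deriv τ t‖ ^ 2 * (Δ ψ) (τ t) := by
  have h1 : fderiv ℝ (fun s => ψ (τ s)) =ᶠ[𝓝 t]
      fun w => (fderiv ℝ ψ (τ w)).comp (fderiv ℝ τ w) := by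
    have e1 : ∀ᶠ w in 𝓝 t, ContDiffAt ℝ 2 ψ (τ w) :=
      hτ.continuousAt.eventually (hψ.eventually (by simp))
    filter_upwards [e1, hτ.eventually_analyticAt] with w hw hw'
    exact fderiv_comp w (hw.differentiableAt (by norm_num))
      (hw'.differentiableAt.restrictScalars ℝ)
  have hd1 : HasFDerivAt (fun w => fderiv ℝ ψ (τ w))
      ((fderiv ℝ (fderiv ℝ ψ) (τ t)).comp (fderiv ℝ τ t)) t :=
    HasFDerivAt.comp t
      ((hψ.fderiv_right (m := 1) (by norm_num)).differentiableAt (by norm_num)).hasFDerivAt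
      (hτ.differentiableAt.restrictScalars ℝ).hasFDerivAt
  have hcomp : ContDiffAt ℝ 2 (fun s => ψ (τ s)) t :=
    hψ.comp t (hτ.contDiffAt.restrict_scalars ℝ)
  -- Second-order chain rule along `v`: `ψ''(τ'v, τ'v) + ψ'(τ'' v²)`.
  have key : ∀ v, fderiv ℝ (fderiv ℝ (fun s => ψ (τ s))) t v v =
      fderiv ℝ (fderiv ℝ ψ) (τ t) (deriv τ t * v) (deriv τ t * v) +
        fderiv ℝ ψ (τ t) (deriv (deriv τ) t * v * v) := by
    intro v
    rw [← fderiv_fderiv_apply hcomp]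
    have h2 : (fun w => fderiv ℝ (fun s => ψ (τ s)) w v) =ᶠ[𝓝 t]
        fun w => fderiv ℝ ψ (τ w) (deriv τ w * v) := by
      filter_upwards [h1, hτ.eventually_analyticAt] with w hw hw'
      rw [hw, ContinuousLinearMap.comp_apply, fderiv_real_apply hw'.differentiableAt]
    rw [h2.fderiv_eq]
    have hd2 : HasFDerivAt (fun w => deriv τ w * v)
        ((fderiv ℝ (deriv τ) t).smulRight v) t := by
      have := (hτ.deriv.differentiableAt.restrictScalars ℝ).hasFDerivAt.mul_const v
      refine this.congr_fderiv ?_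
      ext
      simp [mul_comm]
    rw [(hd1.clm_apply hd2).fderiv]
    have h3 : fderiv ℝ (deriv τ) t v = deriv (deriv τ) t * v :=
      fderiv_real_apply hτ.deriv.differentiableAt v
    simp [fderiv_real_apply hτ.differentiableAt, h3, add_comm]
  rw [laplacian_eq_fderiv_fderiv, laplacian_eq_fderiv_fderiv, key, key]
  generalize fderiv ℝ (fderiv ℝ ψ) (τ t) = B
  -- As `i² = -1`, the two terms with `τ''` cancel in the sum over `v = 1` and `v = i`.
  have hI : fderiv ℝ ψ (τ t) (deriv (deriv τ) t * Complex.I * Complex.I) =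
      - fderiv ℝ ψ (τ t) (deriv (deriv τ) t * 1 * 1) := by
    rw [mul_assoc, Complex.I_mul_I, ← map_neg]; simp
  rw [hI]
  -- The vectors `τ'` and `τ' i` are the basis `1, i` rotated and scaled by `|τ'|`; on expanding `B`
  -- bilinearly the mixed terms cancel.
  have e1 : deriv τ t * 1 = (deriv τ t).re • (1 : ℂ) + (deriv τ t).im • Complex.I := by
    simp
  have e2 : deriv τ t * Complex.I =
      (-(deriv τ t).im) • (1 : ℂ) + (deriv τ t).re • Complex.I := by
    apply Complex.ext <;> simp
  rw [e1, e2, ← Complex.normSq_eq_norm_sq, Complex.normSq_apply]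
  simp only [map_add, map_smul, add_apply, smul_apply,
    smul_eq_mul]
  ring

theorem contDiff_log_add_norm_sq {c : ℝ} (hc : 0 < c) :
    ContDiff ℝ ∞ fun w : ℂ => Real.log (c + ‖w‖ ^ 2) :=
  (contDiff_const.add (contDiff_norm_sq ℝ)).log fun w => by positivity

/-- Serves twice: with `c = 1` it gives the spherical density, and with `c = ε²` it gives the
approximate identity that regularizes `log ‖w‖`. -/
theorem laplacian_log_add_norm_sq {c : ℝ} (hc : 0 < c) (w : ℂ) :
    (Δ fun w : ℂ => Real.log (c + ‖w‖ ^ 2)) w = 4 * c / (c + ‖w‖ ^ 2) ^ 2 := by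
  have hpos : ∀ w : ℂ, c + ‖w‖ ^ 2 ≠ 0 := fun w => by positivity
  have hn : ∀ w : ℂ, HasFDerivAt (fun w : ℂ => c + ‖w‖ ^ 2) (2 • innerSL ℝ w) w := fun w =>
    ((hasStrictFDerivAt_norm_sq w).hasFDerivAt).const_add c
  have h1 : ∀ v : ℂ, (fun w => fderiv ℝ (fun w : ℂ => Real.log (c + ‖w‖ ^ 2)) w v) =
      fun w => 2 * inner ℝ w v / (c + ‖w‖ ^ 2) := by
    intro v
    funext w
    rw [((hn w).log (hpos w)).fderiv]
    simp only [smul_apply, coe_innerSL_apply, smul_eq_mul, nsmul_eq_mul, Nat.cast_ofNat]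
    ring
  have h2 : ∀ v : ℂ, fderiv ℝ (fderiv ℝ fun w : ℂ => Real.log (c + ‖w‖ ^ 2)) w v v =
      2 * ‖v‖ ^ 2 / (c + ‖w‖ ^ 2) - 4 * (inner ℝ w v) ^ 2 / (c + ‖w‖ ^ 2) ^ 2 := by
    intro v
    rw [← fderiv_fderiv_apply (((contDiff_log_add_norm_sq hc).of_le (by norm_cast)).contDiffAt),
      h1]
    have hi : HasFDerivAt (fun w : ℂ => 2 * inner ℝ w v) (2 • innerSL ℝ v) w := by
      have := (((innerSL ℝ v).hasFDerivAt (x := w)).const_mul 2)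
      refine (this.congr_of_eventuallyEq (.of_forall fun w => ?_)).congr_fderiv ?_
      · simp [real_inner_comm]
      · ext; simp only [smul_apply, smul_eq_mul, nsmul_eq_mul, Nat.cast_ofNat]
    have := hi.fun_mul ((hasDerivAt_inv (hpos w)).comp_hasFDerivAt w (hn w))
    simp only [Function.comp_def] at this
    simp only [div_eq_mul_inv] at this ⊢
    rw [this.fderiv]
    simp
    ring
  have h3 : (inner ℝ w (1 : ℂ)) ^ 2 + (inner ℝ w Complex.I) ^ 2 = ‖w‖ ^ 2 := by
    rw [← Complex.normSq_eq_norm_sq, Complex.normSq_apply]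
    simp [Complex.inner]
    ring
  rw [laplacian_eq_fderiv_fderiv, h2, h2]
  have := hpos w
  simp only [norm_one, Complex.norm_I]
  field_simp
  linear_combination (-4) * h3

end PlaneLaplacian

/-! ### Green's identity and the fundamental solution in the plane -/

section PlaneDistributions

open Laplacian InnerProductSpace Filter Topology

theorem integrable_mul_of_tsupport_subset {f g : ℂ → ℝ} {V : Set ℂ} (hf : ContinuousOn f V)
    (hg : Continuous g) (hgc : HasCompactSupport g) (hgV : tsupport g ⊆ V) :
    Integrable (fun t => f t * g t) := by
  rw [← integrableOn_iff_integrable_of_support_subset (s := tsupport g)]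
  · exact ((hf.mono hgV).mul hg.continuousOn).integrableOn_compact hgc
  · exact (Function.support_mul_subset_right _ _).trans (subset_tsupport g)

theorem tsupport_fderiv_apply_subset_tsupport (f : ℂ → ℝ) (v : ℂ) :
    tsupport (fun t => fderiv ℝ f t v) ⊆ tsupport f := by
  have h : Function.support (fun t => fderiv ℝ f t v) ⊆ Function.support (fderiv ℝ f) :=
    fun t ht h => ht (by simp [h])
  exact (closure_mono h).trans (tsupport_fderiv_subset ℝ)

theorem contDiff_fderiv_apply {f : ℂ → ℝ} (hf : ContDiff ℝ ∞ f) (v : ℂ) :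
    ContDiff ℝ ∞ fun t => fderiv ℝ f t v :=
  (hf.fderiv_right (m := ∞) (by simp)).clm_apply contDiff_const

theorem laplacian_eq_sum_fderiv {f : ℂ → ℝ} {z : ℂ} (hf : ContDiffAt ℝ 2 f z) :
    (Δ f) z = fderiv ℝ (fun w => fderiv ℝ f w 1) z 1 +
      fderiv ℝ (fun w => fderiv ℝ f w Complex.I) z Complex.I := by
  rw [laplacian_eq_fderiv_fderiv, fderiv_fderiv_apply hf, fderiv_fderiv_apply hf]

theorem tsupport_laplacian_subset (ψ : ℂ → ℝ) : tsupport (Δ ψ) ⊆ tsupport ψ := by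
  refine closure_minimal (fun t ht => ?_) (isClosed_tsupport ψ)
  by_contra h
  refine ht ?_
  have : ψ =ᶠ[𝓝 t] fun _ => 0 := notMem_tsupport_iff_eventuallyEq.1 h
  rw [laplacian_congr_nhds this |>.eq_of_nhds]
  simp

theorem continuousOn_laplacian {f : ℂ → ℝ} {V : Set ℂ} (hV : IsOpen V)
    (hf : ContDiffOn ℝ ∞ f V) : ContinuousOn (Δ f) V := by
  have h1 : ContDiffOn ℝ ∞ (fderiv ℝ f) V := hf.fderiv_of_isOpen hV (by simp)
  have h2 : ContDiffOn ℝ ∞ (fderiv ℝ (fderiv ℝ f)) V := h1.fderiv_of_isOpen hV (by simp)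
  have h3 := h2.continuousOn
  refine ContinuousOn.congr (f := fun z => fderiv ℝ (fderiv ℝ f) z 1 1 +
      fderiv ℝ (fderiv ℝ f) z Complex.I Complex.I) ?_ fun z _ => laplacian_eq_fderiv_fderiv f z
  fun_prop

/-- Green's second identity for a test function. -/
theorem integral_mul_laplacian {f ψ : ℂ → ℝ} {V : Set ℂ} (hV : IsOpen V)
    (hf : ContDiffOn ℝ ∞ f V) (hψ : ContDiff ℝ ∞ ψ) (hψc : HasCompactSupport ψ)
    (hψV : tsupport ψ ⊆ V) : ∫ t, f t * (Δ ψ) t = ∫ t, (Δ f) t * ψ t := by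
  have hfa : ∀ t ∈ V, ContDiffAt ℝ ∞ f t := fun t ht => hf.contDiffAt (hV.mem_nhds ht)
  have hf1 : ContDiffOn ℝ ∞ (fderiv ℝ f) V := hf.fderiv_of_isOpen hV (by simp)
  have hf1v : ∀ v, ContDiffOn ℝ ∞ (fun t => fderiv ℝ f t v) V := fun v =>
    hf1.clm_apply contDiffOn_const
  have hf2v : ∀ v, ContinuousOn (fun t => fderiv ℝ (fun w => fderiv ℝ f w v) t v) V := fun v =>
    (((hf1v v).fderiv_of_isOpen (m := ∞) hV (by simp)).clm_apply contDiffOn_const).continuousOn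
  have hψ1 := contDiff_fderiv_apply hψ
  have hc1 : ∀ v, HasCompactSupport fun t => fderiv ℝ ψ t v := fun v =>
    hψc.of_isClosed_subset (isClosed_tsupport _) (tsupport_fderiv_apply_subset_tsupport ψ v)
  have hs1 : ∀ v, tsupport (fun t => fderiv ℝ ψ t v) ⊆ V := fun v =>
    (tsupport_fderiv_apply_subset_tsupport ψ v).trans hψV
  have hψ2 := fun v => contDiff_fderiv_apply (hψ1 v)
  have hc2 : ∀ v, HasCompactSupport fun t => fderiv ℝ (fun w => fderiv ℝ ψ w v) t v := fun v =>
    (hc1 v).of_isClosed_subset (isClosed_tsupport _) (tsupport_fderiv_apply_subset_tsupport _ v)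
  have hs2 : ∀ v, tsupport (fun t => fderiv ℝ (fun w => fderiv ℝ ψ w v) t v) ⊆ V := fun v =>
    (tsupport_fderiv_apply_subset_tsupport _ v).trans (hs1 v)
  have i1 : ∀ v, Integrable fun t => f t * fderiv ℝ (fun w => fderiv ℝ ψ w v) t v := fun v =>
    integrable_mul_of_tsupport_subset hf.continuousOn (hψ2 v v).continuous (hc2 v) (hs2 v)
  have i2 : ∀ v, Integrable fun t => fderiv ℝ f t v * fderiv ℝ ψ t v := fun v =>
    integrable_mul_of_tsupport_subset (hf1v v).continuousOn (hψ1 v).continuous (hc1 v) (hs1 v)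
  have i3 : ∀ v, Integrable fun t => f t * fderiv ℝ ψ t v := fun v =>
    integrable_mul_of_tsupport_subset hf.continuousOn (hψ1 v).continuous (hc1 v) (hs1 v)
  have i4 : ∀ v, Integrable fun t => fderiv ℝ (fun w => fderiv ℝ f w v) t v * ψ t := fun v =>
    integrable_mul_of_tsupport_subset (hf2v v) hψ.continuous hψc hψV
  have i5 : ∀ v, Integrable fun t => fderiv ℝ f t v * ψ t := fun v =>
    integrable_mul_of_tsupport_subset (hf1v v).continuousOn hψ.continuous hψc hψV
  -- Two integrations by parts along `v`. Although `f` is smooth only on `V`, each product is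
  -- integrable because its `ψ`-factor has compact support inside `V`.
  have key : ∀ v, ∫ t, f t * fderiv ℝ (fun w => fderiv ℝ ψ w v) t v =
      ∫ t, fderiv ℝ (fun w => fderiv ℝ f w v) t v * ψ t := by
    intro v
    rw [integral_mul_fderiv_eq_neg_fderiv_mul_of_integrable (i2 v) (i1 v) (i3 v)
        (fun t ht => (hfa t (hs1 v ht)).differentiableAt (by simp))
        (fun t _ => ((hψ1 v).differentiable (by simp)) t),
      integral_mul_fderiv_eq_neg_fderiv_mul_of_integrable (i4 v) (i2 v) (i5 v)
        (fun t ht => ((hf1v v).contDiffAt (hV.mem_nhds (hψV ht))).differentiableAt (by simp))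
        (fun t _ => (hψ.differentiable (by simp)) t), neg_neg]
  calc ∫ t, f t * (Δ ψ) t
      = ∫ t, (f t * fderiv ℝ (fun w => fderiv ℝ ψ w 1) t 1 +
          f t * fderiv ℝ (fun w => fderiv ℝ ψ w Complex.I) t Complex.I) := by
        refine integral_congr_ae (.of_forall fun t => ?_)
        simp only
        rw [laplacian_eq_sum_fderiv (hψ.contDiffAt.of_le (by norm_cast)), mul_add]
    _ = ∫ t, (fderiv ℝ (fun w => fderiv ℝ f w 1) t 1 * ψ t +
          fderiv ℝ (fun w => fderiv ℝ f w Complex.I) t Complex.I * ψ t) := by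
        rw [integral_add (i1 _) (i1 _), integral_add (i4 _) (i4 _), key, key]
    _ = ∫ t, (Δ f) t * ψ t := by
        refine integral_congr_ae (.of_forall fun t => ?_)
        simp only
        by_cases ht : t ∈ V
        · rw [laplacian_eq_sum_fderiv ((hfa t ht).of_le (by norm_cast)), add_mul]
        · rw [image_eq_zero_of_notMem_tsupport fun h => ht (hψV h)]
          simp

/-- In polar coordinates the radial integrand `2 r / (1 + r²)²` has the antiderivative `-1 / (1 +
r²)`, of total variation `1`. The value is the mass that `log ‖t‖` carries at the origin. -/
theorem integral_two_div_one_add_norm_sq_sq :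
    Integrable (fun s : ℂ => 2 / (1 + ‖s‖ ^ 2) ^ 2) ∧
      ∫ s : ℂ, 2 / (1 + ‖s‖ ^ 2) ^ 2 = 2 * Real.pi := by
  have hd : ∀ x ∈ Ici (0 : ℝ), HasDerivAt (fun r : ℝ => -(1 + r ^ 2)⁻¹)
      (2 * x / (1 + x ^ 2) ^ 2) x := by
    intro x _
    have h : HasDerivAt (fun r : ℝ => 1 + r ^ 2) (2 * x) x := by
      simpa using (hasDerivAt_pow 2 x).const_add 1
    refine (h.fun_inv (by positivity)).fun_neg.congr_deriv ?_
    ring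
  have ht : Tendsto (fun r : ℝ => -(1 + r ^ 2)⁻¹) atTop (𝓝 0) := by
    rw [← neg_zero]
    refine (tendsto_inv_atTop_zero.comp ?_).neg
    exact tendsto_atTop_add_const_left _ _ (tendsto_pow_atTop (by norm_num))
  have hpos : ∀ x ∈ Ioi (0 : ℝ), 0 ≤ 2 * x / (1 + x ^ 2) ^ 2 := fun x hx => by
    have : (0 : ℝ) < x := hx
    positivity
  have hi := integrableOn_Ioi_deriv_of_nonneg' hd hpos ht
  have hv := integral_Ioi_of_hasDerivAt_of_nonneg' hd hpos ht
  constructor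
  · rw [integrable_fun_norm_addHaar volume (f := fun y : ℝ => 2 / (1 + y ^ 2) ^ 2)]
    refine hi.congr_fun (fun y _ => ?_) measurableSet_Ioi
    simp [Complex.finrank_real_complex]
    ring
  · rw [integral_fun_norm_addHaar volume (fun y : ℝ => 2 / (1 + y ^ 2) ^ 2)]
    have : ∫ y in Ioi (0 : ℝ), y ^ (Module.finrank ℝ ℂ - 1) • (2 / (1 + y ^ 2) ^ 2) = 1 := by
      refine Eq.trans ?_ (by simpa using hv : ∫ y in Ioi (0 : ℝ), 2 * y / (1 + y ^ 2) ^ 2 = 1)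
      refine setIntegral_congr_fun measurableSet_Ioi fun y _ => ?_
      simp [Complex.finrank_real_complex]
      ring
    rw [this]
    simp [Measure.real, Complex.volume_ball, Complex.finrank_real_complex]

/-- From `log s ≤ s - 1`, applied to `‖t‖` and to `‖t‖⁻¹`, follows `|log ‖t‖| ≤ (1 + r²) / ‖t‖` on
the ball, and `‖t‖⁻¹` is integrable near `0` in real dimension two. -/
theorem integrableOn_log_norm_ball (r : ℝ) :
    IntegrableOn (fun t : ℂ => Real.log ‖t‖) (Metric.ball 0 r) := by
  refine integrableOn_ball_of_norm_le_rpow (C := 1 + (max r 0) ^ 2) (α := 1) (by simp)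
    (by simp [Complex.finrank_real_complex]) ?_
    (Real.measurable_log.comp measurable_norm).aestronglyMeasurable
  rw [ae_restrict_iff' measurableSet_ball]
  refine .of_forall fun t ht => ?_
  rw [mem_ball_zero_iff] at ht
  rcases eq_or_ne t 0 with rfl | h0
  · simp
  have hp : 0 < ‖t‖ := norm_pos_iff.2 h0
  rw [Real.rpow_neg_one, Real.norm_eq_abs, ← div_eq_mul_inv, le_div_iff₀ hp]
  have hm : ‖t‖ ≤ max r 0 := ht.le.trans (le_max_left _ _)
  have h1 : Real.log ‖t‖ ≤ ‖t‖ - 1 := Real.log_le_sub_one_of_pos hp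
  have h2 : -(‖t‖⁻¹ - 1) ≤ Real.log ‖t‖ := by
    have := Real.log_le_sub_one_of_pos (inv_pos.2 hp)
    rw [Real.log_inv] at this
    linarith
  have h3 : ‖t‖ * ‖t‖⁻¹ = 1 := mul_inv_cancel₀ hp.ne'
  have h4 : ‖t‖ ^ 2 ≤ (max r 0) ^ 2 := by gcongr
  rcases abs_cases (Real.log ‖t‖) with ⟨h, _⟩ | ⟨h, _⟩ <;> rw [h]
  · nlinarith
  · nlinarith

theorem locallyIntegrable_log_norm : LocallyIntegrable fun t : ℂ => Real.log ‖t‖ := fun t =>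
  ⟨Metric.ball 0 (‖t‖ + 1), Metric.isOpen_ball.mem_nhds (by simp),
    integrableOn_log_norm_ball _⟩

/-- The function `log |t|` is `2π` times a fundamental solution of the Laplacian. -/
theorem integral_log_norm_mul_laplacian {ψ : ℂ → ℝ} (hψ : ContDiff ℝ ∞ ψ)
    (hψc : HasCompactSupport ψ) :
    ∫ t, Real.log ‖t‖ * (Δ ψ) t = 2 * Real.pi * ψ 0 := by
  have hΔ : Continuous (Δ ψ) := by
    rw [← continuousOn_univ]
    exact continuousOn_laplacian isOpen_univ hψ.contDiffOn
  have hΔc : HasCompactSupport (Δ ψ) :=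
    hψc.of_isClosed_subset (isClosed_tsupport _) (tsupport_laplacian_subset ψ)
  -- Replace `log ‖t‖` by the smooth `½ log (ε² + ‖t‖²)`. Its Laplacian `2 ε² / (ε² + ‖t‖²)²` is the
  -- rescaling by `ε` of a fixed density of mass `2π`, so it concentrates at `0`.
  set ε : ℕ → ℝ := fun n => 1 / ((n : ℝ) + 1)
  have hε : ∀ n, 0 < ε n := fun n => by positivity
  have hε1 : ∀ n, ε n ≤ 1 := fun n => by
    rw [div_le_one (by positivity)]; simp
  have hε0 : Tendsto ε atTop (𝓝 0) := tendsto_one_div_add_atTop_nhds_zero_nat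
  have e1 : ∀ n, ∫ t, (1 / 2 * Real.log (ε n ^ 2 + ‖t‖ ^ 2)) * (Δ ψ) t =
      ∫ s : ℂ, 2 / (1 + ‖s‖ ^ 2) ^ 2 * ψ (ε n • s) := by
    intro n
    have hp : 0 < ε n ^ 2 := pow_pos (hε n) 2
    have h := integral_mul_laplacian isOpen_univ
      (contDiff_log_add_norm_sq hp).contDiffOn hψ hψc (subset_univ _)
    simp only [mul_assoc, integral_const_mul]
    rw [h]
    have h2 := Measure.integral_comp_smul (volume : Measure ℂ)
      (fun t : ℂ => 4 * ε n ^ 2 / (ε n ^ 2 + ‖t‖ ^ 2) ^ 2 * ψ t) (ε n)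
    simp only [laplacian_log_add_norm_sq hp]
    rw [Complex.finrank_real_complex, abs_of_pos (by positivity), smul_eq_mul,
      eq_inv_mul_iff_mul_eq₀ hp.ne'] at h2
    rw [← h2, ← integral_const_mul, ← integral_const_mul]
    refine integral_congr_ae (.of_forall fun s => ?_)
    have : ε n ^ 2 + (ε n * ‖s‖) ^ 2 ≠ 0 := by positivity
    have : 1 + ‖s‖ ^ 2 ≠ 0 := by positivity
    simp only [norm_smul, Real.norm_eq_abs, abs_of_pos (hε n)]
    have := (hε n).ne'
    field_simp
    norm_num
  have l1 : Tendsto (fun n => ∫ s : ℂ, 2 / (1 + ‖s‖ ^ 2) ^ 2 * ψ (ε n • s)) atTop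
      (𝓝 (∫ s : ℂ, 2 / (1 + ‖s‖ ^ 2) ^ 2 * ψ 0)) := by
    obtain ⟨M, hM⟩ := hψ.continuous.bounded_above_of_compact_support hψc
    refine tendsto_integral_of_dominated_convergence
      (fun s => 2 / (1 + ‖s‖ ^ 2) ^ 2 * M) (fun n => ?_)
      (integral_two_div_one_add_norm_sq_sq.1.mul_const M) (fun n => ?_) ?_
    · refine (integral_two_div_one_add_norm_sq_sq.1.aestronglyMeasurable).mul ?_
      exact (hψ.continuous.comp (continuous_const_smul _)).aestronglyMeasurable
    · refine .of_forall fun s => ?_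
      rw [norm_mul, Real.norm_of_nonneg (by positivity)]
      gcongr
      exact hM _
    · refine .of_forall fun s => ?_
      refine tendsto_const_nhds.mul ?_
      have : Tendsto (fun n => ε n • s) atTop (𝓝 0) := by
        simpa using hε0.smul_const s
      exact (hψ.continuous.tendsto 0).comp this
  have l2 : Tendsto (fun n => ∫ t, (1 / 2 * Real.log (ε n ^ 2 + ‖t‖ ^ 2)) * (Δ ψ) t) atTop
      (𝓝 (∫ t, Real.log ‖t‖ * (Δ ψ) t)) := by
    -- Since `0 < ε ≤ 1`, the approximants lie between `log ‖t‖` and `½ log (1 + ‖t‖²)`, which gives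
    -- the majorant.
    refine tendsto_integral_of_dominated_convergence
      (fun t => (|Real.log ‖t‖| + 1 / 2 * Real.log (1 + ‖t‖ ^ 2)) * |(Δ ψ) t|) (fun n => ?_)
      ?_ (fun n => ?_) ?_
    · refine Continuous.aestronglyMeasurable ?_
      exact ((contDiff_log_add_norm_sq (pow_pos (hε n) 2)).continuous.const_mul _).mul hΔ
    · have hl : LocallyIntegrable fun t : ℂ =>
          |Real.log ‖t‖| + 1 / 2 * Real.log (1 + ‖t‖ ^ 2) :=
        LocallyIntegrable.add
          (fun t => (locallyIntegrable_log_norm t).imp fun _ h => ⟨h.1, h.2.abs⟩)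
          ((contDiff_log_add_norm_sq one_pos).continuous.const_mul _).locallyIntegrable
      simpa only [smul_eq_mul] using
        hl.integrable_smul_right_of_hasCompactSupport hΔ.abs (hΔc.comp_left abs_zero)
    · have h0 : ∀ᵐ t : ℂ, t ≠ 0 := by simp [ae_iff]
      filter_upwards [h0] with t ht
      have hp : 0 < ‖t‖ := norm_pos_iff.2 ht
      rw [norm_mul, Real.norm_eq_abs, Real.norm_eq_abs]
      gcongr
      have a1 : Real.log ‖t‖ ≤ 1 / 2 * Real.log (ε n ^ 2 + ‖t‖ ^ 2) := by
        have : Real.log (‖t‖ ^ 2) ≤ Real.log (ε n ^ 2 + ‖t‖ ^ 2) :=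
          Real.log_le_log (by positivity) (by linarith [sq_nonneg (ε n)])
        rw [Real.log_pow] at this
        push_cast at this
        linarith
      have a2 : Real.log (ε n ^ 2 + ‖t‖ ^ 2) ≤ Real.log (1 + ‖t‖ ^ 2) := by
        refine Real.log_le_log (by positivity) ?_
        gcongr
        exact pow_le_one₀ (hε n).le (hε1 n)
      have a3 : 0 ≤ Real.log (1 + ‖t‖ ^ 2) := Real.log_nonneg (by linarith [sq_nonneg ‖t‖])
      rw [abs_le]
      constructor <;> linarith [neg_abs_le (Real.log ‖t‖), abs_nonneg (Real.log ‖t‖)]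
    · have h0 : ∀ᵐ t : ℂ, t ≠ 0 := by simp [ae_iff]
      filter_upwards [h0] with t ht
      have hp : 0 < ‖t‖ := norm_pos_iff.2 ht
      refine Tendsto.mul_const _ ?_
      have : Real.log ‖t‖ = 1 / 2 * Real.log (0 ^ 2 + ‖t‖ ^ 2) := by
        rw [zero_pow two_ne_zero, zero_add, Real.log_pow]; push_cast; ring
      rw [this]
      refine Tendsto.const_mul _ (Tendsto.log ?_ (by positivity))
      exact (hε0.pow 2).add_const _
  have := tendsto_nhds_unique l2 (l1.congr fun n => (e1 n).symm)
  rw [this, integral_mul_const, integral_two_div_one_add_norm_sq_sq.2]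

theorem integral_log_norm_sub_mul_laplacian {ψ : ℂ → ℝ} (hψ : ContDiff ℝ ∞ ψ)
    (hψc : HasCompactSupport ψ) (t₀ : ℂ) :
    ∫ t, Real.log ‖t - t₀‖ * (Δ ψ) t = 2 * Real.pi * ψ t₀ := by
  have h := integral_log_norm_mul_laplacian (ψ := fun t => ψ (t + t₀))
    (hψ.comp (contDiff_id.add contDiff_const))
    (hψc.comp_homeomorph (Homeomorph.addRight t₀))
  rw [zero_add] at h
  rw [← h, ← integral_add_right_eq_self _ t₀]
  refine integral_congr_ae (.of_forall fun t => ?_)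
  have := laplacian_comp_analytic (t := t) (τ := fun t => t + t₀)
    (analyticAt_id.add analyticAt_const) (hψ.contDiffAt.of_le (by norm_cast))
  simp [this]

theorem locallyIntegrable_log_norm_sub (t₀ : ℂ) :
    LocallyIntegrable fun t : ℂ => Real.log ‖t - t₀‖ := fun t => by
  refine ⟨Metric.ball t₀ (dist t t₀ + 1), Metric.isOpen_ball.mem_nhds (by simp), ?_⟩
  have h := integrableOn_log_norm_ball (dist t t₀ + 1)
  rw [← (measurePreserving_sub_right volume t₀).integrableOn_comp_preimage
    (MeasurableEquiv.subRight t₀).measurableEmbedding] at h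
  have hb : (fun x => x - t₀) ⁻¹' Metric.ball 0 (dist t t₀ + 1) =
      Metric.ball t₀ (dist t t₀ + 1) := by
    ext s
    simp [dist_eq_norm]
  rwa [hb] at h

/-- The form in which an isolated logarithmic singularity is used: the singular part gives the point
mass, the smooth part obeys Green's identity. The value of `u` at `t₀` is left free, since `Real.log
0 = 0` carries no information there. -/
theorem integral_log_add_mul_laplacian {u h ψ : ℂ → ℝ} {V : Set ℂ} {t₀ : ℂ} {n : ℝ}
    (hV : IsOpen V) (hh : ContDiffOn ℝ ∞ h V)
    (hu : ∀ t ∈ V, t ≠ t₀ → u t = n * Real.log ‖t - t₀‖ + h t)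
    (hψ : ContDiff ℝ ∞ ψ) (hψc : HasCompactSupport ψ) (hψV : tsupport ψ ⊆ V) :
    ∫ t, u t * (Δ ψ) t = 2 * Real.pi * n * ψ t₀ + ∫ t, (Δ h) t * ψ t := by
  have hΔ : Continuous (Δ ψ) := by
    rw [← continuousOn_univ]
    exact continuousOn_laplacian isOpen_univ hψ.contDiffOn
  have hΔV : tsupport (Δ ψ) ⊆ V := (tsupport_laplacian_subset ψ).trans hψV
  have hΔc : HasCompactSupport (Δ ψ) :=
    hψc.of_isClosed_subset (isClosed_tsupport _) (tsupport_laplacian_subset ψ)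
  have h0 : ∀ᵐ t : ℂ, t ≠ t₀ := by simp [ae_iff]
  have e1 : ∫ t, u t * (Δ ψ) t =
      ∫ t, (n * (Real.log ‖t - t₀‖ * (Δ ψ) t) + h t * (Δ ψ) t) := by
    refine integral_congr_ae ?_
    filter_upwards [h0] with t ht
    by_cases htV : t ∈ V
    · rw [hu t htV ht]; ring
    · rw [image_eq_zero_of_notMem_tsupport fun h => htV (hΔV h)]; simp
  have i1 : Integrable fun t => n * (Real.log ‖t - t₀‖ * (Δ ψ) t) := by
    simpa only [smul_eq_mul] using ((locallyIntegrable_log_norm_sub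
      t₀).integrable_smul_right_of_hasCompactSupport hΔ hΔc).const_mul n
  rw [e1, integral_add i1 (integrable_mul_of_tsupport_subset hh.continuousOn hΔ hΔc hΔV),
    integral_const_mul, integral_log_norm_sub_mul_laplacian hψ hψc,
    integral_mul_laplacian hV hh hψ hψc hψV]
  ring

/-- The pullback of the spherical potential has the pullback of the spherical density as its
Laplacian. -/
theorem laplacian_log_one_add_norm_sq_comp {a : ℂ → ℂ} {t : ℂ} (ha : AnalyticAt ℂ a t) :
    (Δ fun s => Real.log (1 + ‖a s‖ ^ 2)) t =
      4 * (‖deriv a t‖ ^ 2 / (1 + ‖a t‖ ^ 2) ^ 2) := by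
  have := laplacian_comp_analytic (ψ := fun w => Real.log (1 + ‖w‖ ^ 2)) ha
    ((contDiff_log_add_norm_sq one_pos).contDiffAt.of_le (by norm_cast))
  rw [this, laplacian_log_add_norm_sq one_pos]
  ring

end PlaneDistributions

namespace GenusTwoCurve

variable (C : GenusTwoCurve)

/-! ### Points of the curve and the functions `F_R` on the two affine pieces -/

section Points

theorem exists_rep (P : C.Pt) : (∃ a, C.inc₀ a = P) ∨ ∃ b, C.inc₁ b = P := by
  induction P using Quotient.inductionOn with
  | h s =>
    rcases s with a | b
    · exact Or.inl ⟨a, rfl⟩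
    · exact Or.inr ⟨b, rfl⟩

theorem inc₁_mem_range_inc₀ (b : C.C₁) : C.inc₁ b ∈ range C.inc₀ ↔ b.1.1 ≠ 0 := by
  constructor
  · rintro ⟨a, ha⟩
    obtain ⟨h1, h2, -⟩ := (C.inc₀_eq_inc₁ a b).1 ha
    rw [h2]
    exact inv_ne_zero h1
  · intro h0
    refine ⟨⟨(b.1.1⁻¹, b.1.2 / b.1.1 ^ 3), ?_⟩, ?_⟩
    · change (b.1.2 / b.1.1 ^ 3) ^ 2 = C.f.eval b.1.1⁻¹
      rw [C.f_eval _ h0, ← b.2]; field_simp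
    · refine (C.inc₀_eq_inc₁ _ b).2 ⟨inv_ne_zero h0, by simp, ?_⟩
      simp only
      field_simp

/-- Every point is a point of `C₀` or one of the points at infinity of `C₀'`. -/
theorem exists_rep_finite_or_infinite (P : C.Pt) :
    (∃ a, C.inc₀ a = P) ∨ P ∉ range C.inc₀ ∧ ∃ b, b.1.1 = 0 ∧ C.inc₁ b = P := by
  by_cases h : P ∈ range C.inc₀
  · exact Or.inl h
  · obtain ⟨a, rfl⟩ | ⟨b, rfl⟩ := C.exists_rep P
    · exact absurd ⟨a, rfl⟩ h
    · exact Or.inr ⟨h, b, by simpa using (C.inc₁_mem_range_inc₀ b).not.1 h, rfl⟩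

theorem inc₀_injective : Function.Injective C.inc₀ := C.isOpenEmbedding_inc₀.injective

theorem inc₁_injective : Function.Injective C.inc₁ := C.isOpenEmbedding_inc₁.injective

theorem F_inc₀_inc₀ (r q : C.C₀) :
    C.F (C.inc₀ r) (C.inc₀ q) = ‖q.1.1 - r.1.1‖ / √(1 + ‖q.1.1‖ ^ 2) := by
  rw [F, if_pos ⟨r, rfl⟩, if_pos ⟨q, rfl⟩]; rfl

theorem F_inc₀ {R : C.Pt} (hR : R ∉ range C.inc₀) (q : C.C₀) :
    C.F R (C.inc₀ q) = 1 / √(1 + ‖q.1.1‖ ^ 2) := by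
  rw [F, if_neg hR, if_pos ⟨q, rfl⟩]; rfl

theorem x_inc₁ (b : C.C₁) : C.x (C.inc₁ b) = b.1.1⁻¹ := rfl

theorem sqrt_one_add_norm_inv_sq {z : ℂ} (hz : z ≠ 0) :
    √(1 + ‖z⁻¹‖ ^ 2) = √(1 + ‖z‖ ^ 2) / ‖z‖ := by
  have h : 0 < ‖z‖ := norm_pos_iff.2 hz
  rw [← Real.sqrt_sq h.le, ← Real.sqrt_div (by positivity), Real.sqrt_sq h.le, norm_inv]
  congr 1
  field_simp
  ring

/-- The definition of `F` uses the `z`-formula only at infinity. On the overlap it agrees with the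
`x`-formula because `|x - r| / √(1 + |x|²)` is homogeneous: multiply numerator and denominator by
`|z|`, with `x = 1/z`. -/
theorem F_inc₀_inc₁ (r : C.C₀) (q : C.C₁) :
    C.F (C.inc₀ r) (C.inc₁ q) = ‖1 - q.1.1 * r.1.1‖ / √(1 + ‖q.1.1‖ ^ 2) := by
  rw [F, if_pos ⟨r, rfl⟩]
  split_ifs with h
  · rw [C.inc₁_mem_range_inc₀] at h
    have h' : 0 < ‖q.1.1‖ := norm_pos_iff.2 h
    rw [x_inc₁, sqrt_one_add_norm_inv_sq h]
    have : q.1.1⁻¹ - C.x (C.inc₀ r) = (1 - q.1.1 * r.1.1) / q.1.1 := by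
      change q.1.1⁻¹ - r.1.1 = _
      field_simp
    rw [this, norm_div]
    field_simp
  · rfl

theorem F_inc₁ {R : C.Pt} (hR : R ∉ range C.inc₀) (q : C.C₁) :
    C.F R (C.inc₁ q) = ‖q.1.1‖ / √(1 + ‖q.1.1‖ ^ 2) := by
  rw [F, if_neg hR]
  split_ifs with h
  · rw [C.inc₁_mem_range_inc₀] at h
    have h' : 0 < ‖q.1.1‖ := norm_pos_iff.2 h
    rw [x_inc₁, sqrt_one_add_norm_inv_sq h]
    field_simp
  · rfl

theorem F_nonneg (R Q : C.Pt) : 0 ≤ C.F R Q := by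
  rw [F]; split_ifs <;> positivity

theorem affine_eq_or_eq_neg {p : ℂ[X]} {a b : AffineCurve p} (h : a.1.1 = b.1.1) :
    a = b ∨ a = AffineCurve.neg b := by
  have : a.1.2 ^ 2 = b.1.2 ^ 2 := by rw [a.2, b.2, h]
  rcases sq_eq_sq_iff_eq_or_eq_neg.1 this with h' | h'
  · exact Or.inl (Subtype.ext (Prod.ext h h'))
  · exact Or.inr (Subtype.ext (Prod.ext h h'))

theorem involution_mem_range_inc₀ (a : C.C₀) : C.involution (C.inc₀ a) ∈ range C.inc₀ :=
  ⟨AffineCurve.neg a, rfl⟩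

/-- The function `F_R` vanishes exactly at `R` and its conjugate. -/
theorem F_eq_zero_iff (R Q : C.Pt) : C.F R Q = 0 ↔ Q = R ∨ Q = C.involution R := by
  have hs : ∀ z : ℂ, √(1 + ‖z‖ ^ 2) ≠ 0 := fun z => by positivity
  obtain ⟨r, rfl⟩ | ⟨hR, r, hr, rfl⟩ := C.exists_rep_finite_or_infinite R
  · obtain ⟨q, rfl⟩ | ⟨hQ, q, hq, rfl⟩ := C.exists_rep_finite_or_infinite Q
    · rw [F_inc₀_inc₀, div_eq_zero_iff, or_iff_left (hs _), norm_eq_zero, sub_eq_zero]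
      constructor
      · intro h
        exact (affine_eq_or_eq_neg h).imp (congrArg C.inc₀) (congrArg C.inc₀)
      · rintro (h | h)
        · rw [C.inc₀_injective h]
        · rw [C.inc₀_injective (a₂ := AffineCurve.neg r) h]; rfl
    · rw [F_inc₀_inc₁, hq]
      refine iff_of_false (by simp) ?_
      rintro (h | h)
      · exact hQ (h ▸ ⟨r, rfl⟩)
      · exact hQ (h ▸ C.involution_mem_range_inc₀ r)
  · obtain ⟨q, rfl⟩ | ⟨hQ, q, hq, rfl⟩ := C.exists_rep_finite_or_infinite Q
    · rw [C.F_inc₀ hR]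
      refine iff_of_false (one_div_ne_zero (hs _)) ?_
      rintro (h | h)
      · exact hR ⟨q, h⟩
      · exact (C.inc₁_mem_range_inc₀ (AffineCurve.neg r)).1 ⟨q, h⟩ hr
    · rw [C.F_inc₁ hR, hq]
      refine iff_of_true (by simp) ?_
      exact (affine_eq_or_eq_neg (hq.trans hr.symm)).imp (congrArg C.inc₁) (congrArg C.inc₁)

theorem involution_involution (P : C.Pt) : C.involution (C.involution P) = P := by
  obtain ⟨a, rfl⟩ | ⟨b, rfl⟩ := C.exists_rep P
  · exact congrArg C.inc₀ (Subtype.ext (Prod.ext rfl (neg_neg a.1.2)))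
  · exact congrArg C.inc₁ (Subtype.ext (Prod.ext rfl (neg_neg b.1.2)))

theorem inc₀_mem_weierstrassPoints (a : C.C₀) : C.inc₀ a ∈ C.weierstrassPoints ↔ a.1.2 = 0 := by
  constructor
  · rintro (⟨a', h, e⟩ | ⟨b, h, e⟩)
    · rwa [← C.inc₀_injective e]
    · obtain ⟨h1, -, h3⟩ := (C.inc₀_eq_inc₁ a b).1 e.symm
      rw [h, eq_comm, div_eq_zero_iff] at h3
      exact h3.resolve_right (pow_ne_zero _ h1)
  · exact fun h => Or.inl ⟨a, h, rfl⟩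

theorem inc₁_mem_weierstrassPoints (b : C.C₁) : C.inc₁ b ∈ C.weierstrassPoints ↔ b.1.2 = 0 := by
  constructor
  · rintro (⟨a, h, e⟩ | ⟨b', h, e⟩)
    · obtain ⟨h1, -, h3⟩ := (C.inc₀_eq_inc₁ a b).1 e
      rw [h3, h, zero_div]
    · rwa [← C.inc₁_injective e]
  · exact fun h => Or.inr ⟨b, h, rfl⟩

end Points

/-! ### The product of the functions of the six branch points -/

section Weierstrass

variable {P : Fin 6 → C.Pt}

open Classical in
/-- The indices of the finite branch points. -/
def finiteBranch (P : Fin 6 → C.Pt) : Finset (Fin 6) := {i | P i ∈ range C.inc₀}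

/-- The finite Weierstrass points are exactly the points `(r, 0)` with `r` a root of `f`, and the
roots of the monic separable `f` are simple. -/
theorem f_eq_prod (hP : Function.Injective P) (hPW : range P = C.weierstrassPoints) :
    C.f = ∏ i ∈ C.finiteBranch P, (X - Polynomial.C (C.x (P i))) := by
  classical
  have hmem : ∀ i, i ∈ C.finiteBranch P ↔ P i ∈ range C.inc₀ := fun i => by simp [finiteBranch]
  have hsep : C.f.Separable := PerfectField.separable_iff_squarefree.2 C.squarefree
  have hinj : Set.InjOn (fun i => C.x (P i)) (C.finiteBranch P) := by
    intro i hi j hj hij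
    obtain ⟨a, ha⟩ := (hmem i).1 hi
    obtain ⟨b, hb⟩ := (hmem j).1 hj
    have ha0 : a.1.2 = 0 := by
      rw [← C.inc₀_mem_weierstrassPoints, ha, ← hPW]; exact ⟨i, rfl⟩
    have hb0 : b.1.2 = 0 := by
      rw [← C.inc₀_mem_weierstrassPoints, hb, ← hPW]; exact ⟨j, rfl⟩
    have hab : a.1.1 = b.1.1 := by
      simp only [← ha, ← hb] at hij; exact hij
    refine hP ?_
    rw [← ha, ← hb, show a = b from Subtype.ext (Prod.ext hab (ha0.trans hb0.symm))]
  have hroots : C.f.roots.toFinset = (C.finiteBranch P).image fun i => C.x (P i) := by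
    ext r
    rw [Multiset.mem_toFinset, mem_roots C.monic.ne_zero, Finset.mem_image, IsRoot.def]
    constructor
    · intro hr
      let a : C.C₀ := ⟨(r, 0), by simp [hr]⟩
      have : C.inc₀ a ∈ range P := by
        rw [hPW, C.inc₀_mem_weierstrassPoints]
      obtain ⟨i, hi⟩ := this
      exact ⟨i, (hmem i).2 ⟨a, hi.symm⟩, by rw [hi]; rfl⟩
    · rintro ⟨i, hi, rfl⟩
      obtain ⟨a, ha⟩ := (hmem i).1 hi
      have ha0 : a.1.2 = 0 := by
        rw [← C.inc₀_mem_weierstrassPoints, ha, ← hPW]; exact ⟨i, rfl⟩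
      have := a.2
      rw [ha0] at this
      rw [← ha, show C.x (C.inc₀ a) = a.1.1 from rfl]
      simpa using this.symm
  have h1 : C.f = (C.f.roots.map fun r => X - Polynomial.C r).prod :=
    (IsAlgClosed.splits C.f).eq_prod_roots_of_monic C.monic
  conv_lhs => rw [h1]
  rw [← Finset.prod_image (f := fun r => X - Polynomial.C r) (g := fun i => C.x (P i)) hinj,
    ← hroots, Finset.prod, Multiset.toFinset_val, (nodup_roots hsep).dedup]

/-- Hence `6 - deg f` branch points, none or one, lie at infinity; this is the exponent of `z` in
the factorization of `g`. -/
theorem card_finiteBranch (hP : Function.Injective P) (hPW : range P = C.weierstrassPoints) :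
    (C.finiteBranch P).card = C.f.natDegree := by
  conv_rhs => rw [C.f_eq_prod hP hPW]
  rw [natDegree_prod_of_monic _ _ fun i _ => monic_X_sub_C _]
  simp

theorem prod_eq_finiteBranch {M : Type*} [CommMonoid M] (u : Fin 6 → M) (c : M)
    (hu : ∀ i ∉ C.finiteBranch P, u i = c) :
    ∏ i, u i = (∏ i ∈ C.finiteBranch P, u i) * c ^ (6 - (C.finiteBranch P).card) := by
  rw [← Finset.prod_mul_prod_compl (C.finiteBranch P) u]
  congr 1
  rw [Finset.prod_congr rfl (g := fun _ => c) fun i hi => hu i (Finset.mem_compl.1 hi),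
    Finset.prod_const, Finset.card_compl, Fintype.card_fin]

theorem notMem_finiteBranch {i : Fin 6} : i ∉ C.finiteBranch P ↔ P i ∉ range C.inc₀ := by
  simp [finiteBranch]

theorem sqrt_pow_six (r : ℝ) : √(1 + r ^ 2) ^ 6 = (1 + r ^ 2) ^ 3 := by
  rw [show 6 = 2 * 3 from rfl, pow_mul, Real.sq_sqrt (by positivity)]

/-- On `C₀`, the product of the functions of the branch points is `|y|² / (1 + |x|²)³`. -/
theorem prod_F_inc₀ (hP : Function.Injective P) (hPW : range P = C.weierstrassPoints) (q : C.C₀) :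
    ∏ i, C.F (P i) (C.inc₀ q) = ‖q.1.2‖ ^ 2 / (1 + ‖q.1.1‖ ^ 2) ^ 3 := by
  have h1 : ∀ i, C.F (P i) (C.inc₀ q) =
      (if i ∈ C.finiteBranch P then ‖q.1.1 - C.x (P i)‖ else 1) / √(1 + ‖q.1.1‖ ^ 2) := by
    intro i
    split_ifs with hi
    · obtain ⟨a, ha⟩ := not_not.1 (C.notMem_finiteBranch.not.1 (not_not.2 hi))
      rw [← ha, C.F_inc₀_inc₀]; rfl
    · rw [C.F_inc₀ (C.notMem_finiteBranch.1 hi)]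
  simp only [h1]
  rw [Finset.prod_div_distrib, Finset.prod_const, Finset.card_univ, Fintype.card_fin,
    sqrt_pow_six, Finset.prod_ite_mem, Finset.univ_inter, ← norm_prod, ← norm_pow q.1.2, q.2,
    congrArg (eval q.1.1) (C.f_eq_prod hP hPW)]
  simp [eval_prod]

/-- On `C₀'`, the product of the functions of the branch points is `|w|² / (1 + |z|²)³`. -/
theorem prod_F_inc₁ (hP : Function.Injective P) (hPW : range P = C.weierstrassPoints) (q : C.C₁) :
    ∏ i, C.F (P i) (C.inc₁ q) = ‖q.1.2‖ ^ 2 / (1 + ‖q.1.1‖ ^ 2) ^ 3 := by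
  have h1 : ∀ i, C.F (P i) (C.inc₁ q) =
      ‖if i ∈ C.finiteBranch P then 1 - q.1.1 * C.x (P i) else q.1.1‖ / √(1 + ‖q.1.1‖ ^ 2) := by
    intro i
    split_ifs with hi
    · obtain ⟨a, ha⟩ := not_not.1 (C.notMem_finiteBranch.not.1 (not_not.2 hi))
      rw [← ha, C.F_inc₀_inc₁]; rfl
    · rw [C.F_inc₁ (C.notMem_finiteBranch.1 hi)]
  have h2 : (∏ i, if i ∈ C.finiteBranch P then 1 - q.1.1 * C.x (P i) else q.1.1) =
      C.g.eval q.1.1 := by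
    rw [C.prod_eq_finiteBranch _ q.1.1 fun i hi => if_neg hi, C.card_finiteBranch hP hPW,
      Finset.prod_congr rfl fun i hi => if_pos hi]
    -- At `z = 0` the value `g 0` is the coefficient of `x⁶` in `f`: `0` in degree five, `1` in
    -- degree six. The other side is `0 ^ (6 - deg f)`, which agrees in both cases.
    rcases eq_or_ne q.1.1 0 with h0 | h0
    · rw [h0, ← coeff_zero_eq_eval_zero, g, coeff_reflect]
      have h6 : revAt 6 0 = 6 := by rw [revAt_le (by norm_num)]
      have := C.monic.coeff_natDegree
      rcases C.natDegree_eq with h | h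
      · rw [h6, coeff_eq_zero_of_natDegree_lt (by omega), h]; simp
      · rw [h] at this
        rw [h6, this, h]; simp
    · have h3 := C.g_eval q.1.1⁻¹ (inv_ne_zero h0)
      rw [inv_inv] at h3
      rw [h3]
      -- For `z ≠ 0`, each root factor is `1/z - r = (1 - z r) / z`; the denominators use up `z ^
      -- deg f` of the factor `z⁶` in `g z = z⁶ f (1/z)`.
      have h4 : C.f.eval q.1.1⁻¹ =
          (∏ i ∈ C.finiteBranch P, (1 - q.1.1 * C.x (P i))) / q.1.1 ^ C.f.natDegree := by
        conv_lhs => rw [C.f_eq_prod hP hPW]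
        rw [← C.card_finiteBranch hP hPW, ← Finset.prod_const, ← Finset.prod_div_distrib,
          eval_prod]
        refine Finset.prod_congr rfl fun i _ => ?_
        simp only [eval_sub, eval_X, eval_C]
        field_simp
      rw [h4]
      have h5 : q.1.1 ^ 6 = q.1.1 ^ C.f.natDegree * q.1.1 ^ (6 - C.f.natDegree) := by
        rw [← pow_add, Nat.add_sub_cancel' C.natDegree_le]
      have := pow_ne_zero C.f.natDegree h0
      rw [inv_pow, div_inv_eq_mul, h5]
      field_simp
  simp only [h1]
  rw [Finset.prod_div_distrib, Finset.prod_const, Finset.card_univ, Fintype.card_fin,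
    sqrt_pow_six, ← norm_prod, h2, ← norm_pow q.1.2, q.2]

end Weierstrass

end GenusTwoCurve

/-! ### Local models: both kinds of charts described by one affine equation -/

namespace GenusTwoCurve

variable (C : GenusTwoCurve)

open Filter Topology

/-- In the chart `e` the curve is parametrized by `t ↦ (a t, b t)`, with `b ^ 2 = p a` one of its two
affine equations. -/
structure LocalModel (e : OpenPartialHomeomorph C.Pt ℂ) (p : ℂ[X]) (a b : ℂ → ℂ) : Prop where
  nonsingular : ∀ r, p.eval r = 0 → p.derivative.eval r ≠ 0
  analyticAt_fst : ∀ t ∈ e.target, AnalyticAt ℂ a t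
  analyticAt_snd : ∀ t ∈ e.target, AnalyticAt ℂ b t
  eqn : ∀ t ∈ e.target, b t ^ 2 = p.eval (a t)
  immersion : ∀ t ∈ e.target, deriv a t ≠ 0 ∨ deriv b t ≠ 0
  conformalFactor_eq : ∀ t ∈ e.target, C.conformalFactor e t =
    ‖formCoeff p (fun s => (a s, b s)) t‖ ^ 2 * (1 + ‖a t‖ ^ 2)
  F_eq : ∀ R, ∃ l m : ℂ, (l ≠ 0 ∨ m ≠ 0) ∧ ∀ t ∈ e.target,
    C.F R (e.symm t) = ‖l * a t + m‖ / √(1 + ‖a t‖ ^ 2)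
  weierstrass_iff : ∀ t ∈ e.target, e.symm t ∈ C.weierstrassPoints ↔ b t = 0
  prod_F : ∀ P : Fin 6 → C.Pt, Function.Injective P → range P = C.weierstrassPoints →
    ∀ t ∈ e.target, ∏ i, C.F (P i) (e.symm t) = ‖b t‖ ^ 2 / (1 + ‖a t‖ ^ 2) ^ 3

theorem formCoeff_of_ne {p : ℂ[X]} {γ : ℂ → ℂ × ℂ} {t : ℂ} (h : (γ t).2 ≠ 0) :
    formCoeff p γ t = deriv (fun s => (γ s).1) t / (γ t).2 := by
  rw [formCoeff, if_pos h]

theorem formCoeff_of_eq {p : ℂ[X]} {γ : ℂ → ℂ × ℂ} {t : ℂ} (h : (γ t).2 = 0) :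
    formCoeff p γ t = 2 * deriv (fun s => (γ s).2) t / p.derivative.eval (γ t).1 := by
  rw [formCoeff, if_neg (not_not.2 h)]

/-- The relation `dx / y = -z dz / w` on `C₀ ∩ C₀'`. -/
theorem formCoeff_glue {a b : ℂ → ℂ} {t : ℂ} (ha : DifferentiableAt ℂ a t)
    (hb : DifferentiableAt ℂ b t) (h0 : a t ≠ 0) (heq : b t ^ 2 = C.g.eval (a t)) :
    formCoeff C.f (fun s => ((a s)⁻¹, b s / a s ^ 3)) t =
      -a t * formCoeff C.g (fun s => (a s, b s)) t := by
  by_cases hbt : b t = 0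
  · rw [formCoeff_of_eq (by simp [hbt]), formCoeff_of_eq (by simpa using hbt)]
    have hg : C.g.eval (a t) = 0 := by rw [← heq, hbt]; simp
    have hg' := C.g_nonsingular _ hg
    have h1 : deriv (fun s => b s / a s ^ 3) t = deriv b t / a t ^ 3 := by
      rw [deriv_fun_div hb (ha.fun_pow 3) (pow_ne_zero _ h0), hbt]
      field_simp
      simp
    -- Differentiate `f (1/r) = g r / r⁶` at `r = a t`, where the term containing `g (a t)`
    -- vanishes.
    have h2 : C.f.derivative.eval (a t)⁻¹ = -C.g.derivative.eval (a t) / a t ^ 4 := by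
      have e1 : HasDerivAt (fun r => C.f.eval r⁻¹)
          (C.f.derivative.eval (a t)⁻¹ * (-(a t ^ 2)⁻¹)) (a t) :=
        (C.f.hasDerivAt (a t)⁻¹).comp (a t) (hasDerivAt_inv h0)
      have e2 : HasDerivAt (fun r => C.g.eval r / r ^ 6)
          ((C.g.derivative.eval (a t) * a t ^ 6 - C.g.eval (a t) * (6 * a t ^ 5)) /
            (a t ^ 6) ^ 2) (a t) := by
        have := (C.g.hasDerivAt (a t)).fun_div (hasDerivAt_pow 6 (a t)) (pow_ne_zero _ h0)
        simpa only [Nat.cast_ofNat, Nat.reduceSub] using this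
      have e3 : (fun r => C.f.eval r⁻¹) =ᶠ[𝓝 (a t)] fun r => C.g.eval r / r ^ 6 := by
        filter_upwards [isOpen_ne.mem_nhds h0] with r hr using C.f_eval r hr
      have := e1.unique (e2.congr_of_eventuallyEq e3)
      rw [hg] at this
      field_simp at this ⊢
      refine mul_left_cancel₀ h0 ?_
      linear_combination -this
    simp only [h1, h2]
    field_simp
  · rw [formCoeff_of_ne (by simp [hbt, h0]), formCoeff_of_ne (by simpa using hbt)]
    simp only [deriv_fun_inv'' ha h0]
    field_simp

/-- The parametrization is an immersion because one of its two components is the identity of the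
chart. The numerator of `F_R` is `x - r` for a finite `R` and the constant `1` for `R` at infinity.
-/
theorem localModel_inc₀ {c : OpenPartialHomeomorph C.C₀ ℂ}
    (hc : AffineCurve.IsCoordinateChart c) :
    C.LocalModel (c.lift_openEmbedding C.isOpenEmbedding_inc₀) C.f
      (fun t => (c.symm t).1.1) (fun t => (c.symm t).1.2) where
  nonsingular := C.f_nonsingular
  analyticAt_fst t ht := ((hc.2.contDiffAt (c.open_target.mem_nhds ht)).fst).analyticAt
  analyticAt_snd t ht := ((hc.2.contDiffAt (c.open_target.mem_nhds ht)).snd).analyticAt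
  eqn t _ := (c.symm t).2
  immersion t ht := by
    have hev : ∀ᶠ s in 𝓝 t, s ∈ c.target := c.open_target.mem_nhds ht
    rcases hc.1 with h | h
    · left
      have : (fun s => (c.symm s).1.1) =ᶠ[𝓝 t] id := by
        filter_upwards [hev] with s hs
        rw [← h _ (c.map_target hs), c.right_inv hs, id]
      rw [this.deriv_eq]; simp
    · right
      have : (fun s => (c.symm s).1.2) =ᶠ[𝓝 t] id := by
        filter_upwards [hev] with s hs
        rw [← h _ (c.map_target hs), c.right_inv hs, id]
      rw [this.deriv_eq]; simp
  conformalFactor_eq t ht := by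
    have hr : (c.lift_openEmbedding C.isOpenEmbedding_inc₀).symm t ∈ range C.inc₀ :=
      ⟨c.symm t, rfl⟩
    rw [conformalFactor, holForm, if_pos hr, Fin.sum_univ_two]
    change ‖formCoeff C.f (fun s => ((c.symm s).1.1, (c.symm s).1.2)) t‖ ^ 2 +
      ‖(c.symm t).1.1 * formCoeff C.f (fun s => ((c.symm s).1.1, (c.symm s).1.2)) t‖ ^ 2 = _
    rw [norm_mul]
    ring
  F_eq R := by
    by_cases hR : R ∈ range C.inc₀
    · obtain ⟨r, rfl⟩ := hR
      refine ⟨1, -r.1.1, by simp, fun t _ => ?_⟩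
      refine (C.F_inc₀_inc₀ r (c.symm t)).trans ?_
      rw [one_mul, sub_eq_add_neg]
    · refine ⟨0, 1, by simp, fun t _ => ?_⟩
      refine (C.F_inc₀ hR (c.symm t)).trans ?_
      simp
  weierstrass_iff t _ := C.inc₀_mem_weierstrassPoints (c.symm t)
  prod_F P hP hPW t _ := C.prod_F_inc₀ hP hPW (c.symm t)

/-- On the overlap `holForm` is expressed in `(x, y)`; `formCoeff_glue` rewrites it in `(z, w)`,
where the pair `(-z, -1) dz / w` has the same shape of squared norm as `(1, x) dx / y`. The
numerator of `F_R` is now `1 - r z` or `z`. -/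
theorem localModel_inc₁ {c : OpenPartialHomeomorph C.C₁ ℂ}
    (hc : AffineCurve.IsCoordinateChart c) :
    C.LocalModel (c.lift_openEmbedding C.isOpenEmbedding_inc₁) C.g
      (fun t => (c.symm t).1.1) (fun t => (c.symm t).1.2) where
  nonsingular := C.g_nonsingular
  analyticAt_fst t ht := ((hc.2.contDiffAt (c.open_target.mem_nhds ht)).fst).analyticAt
  analyticAt_snd t ht := ((hc.2.contDiffAt (c.open_target.mem_nhds ht)).snd).analyticAt
  eqn t _ := (c.symm t).2
  immersion t ht := by
    have hev : ∀ᶠ s in 𝓝 t, s ∈ c.target := c.open_target.mem_nhds ht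
    rcases hc.1 with h | h
    · left
      have : (fun s => (c.symm s).1.1) =ᶠ[𝓝 t] id := by
        filter_upwards [hev] with s hs
        rw [← h _ (c.map_target hs), c.right_inv hs, id]
      rw [this.deriv_eq]; simp
    · right
      have : (fun s => (c.symm s).1.2) =ᶠ[𝓝 t] id := by
        filter_upwards [hev] with s hs
        rw [← h _ (c.map_target hs), c.right_inv hs, id]
      rw [this.deriv_eq]; simp
  conformalFactor_eq t ht := by
    rw [conformalFactor, holForm]
    split_ifs with hr
    · have h0 : (c.symm t).1.1 ≠ 0 := (C.inc₁_mem_range_inc₀ (c.symm t)).1 hr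
      have h := C.formCoeff_glue
        ((hc.2.contDiffAt (c.open_target.mem_nhds ht)).fst.differentiableAt (by simp))
        ((hc.2.contDiffAt (c.open_target.mem_nhds ht)).snd.differentiableAt (by simp)) h0
        (c.symm t).2
      rw [Fin.sum_univ_two]
      change ‖formCoeff C.f
          (fun s => ((c.symm s).1.1⁻¹, (c.symm s).1.2 / (c.symm s).1.1 ^ 3)) t‖ ^ 2 +
        ‖(c.symm t).1.1⁻¹ * formCoeff C.f
          (fun s => ((c.symm s).1.1⁻¹, (c.symm s).1.2 / (c.symm s).1.1 ^ 3)) t‖ ^ 2 = _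
      rw [h, neg_mul, mul_neg, inv_mul_cancel_left₀ h0, norm_neg, norm_neg, norm_mul]
      ring
    · rw [Fin.sum_univ_two]
      change ‖-(c.symm t).1.1 * formCoeff C.g (fun s => ((c.symm s).1.1, (c.symm s).1.2)) t‖ ^ 2 +
        ‖-formCoeff C.g (fun s => ((c.symm s).1.1, (c.symm s).1.2)) t‖ ^ 2 = _
      rw [neg_mul, norm_neg, norm_neg, norm_mul]
      ring
  F_eq R := by
    by_cases hR : R ∈ range C.inc₀
    · obtain ⟨r, rfl⟩ := hR
      refine ⟨-r.1.1, 1, by simp, fun t _ => ?_⟩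
      refine (C.F_inc₀_inc₁ r (c.symm t)).trans ?_
      congr 2
      ring
    · refine ⟨1, 0, by simp, fun t _ => ?_⟩
      refine (C.F_inc₁ hR (c.symm t)).trans ?_
      simp
  weierstrass_iff t _ := C.inc₁_mem_weierstrassPoints (c.symm t)
  prod_F P hP hPW t _ := C.prod_F_inc₁ hP hPW (c.symm t)

theorem exists_localModel {e : OpenPartialHomeomorph C.Pt ℂ} (he : e ∈ C.charts) :
    ∃ p a b, C.LocalModel e p a b := by
  rcases he with ⟨c, hc, rfl⟩ | ⟨c, hc, rfl⟩
  · exact ⟨_, _, _, C.localModel_inc₀ hc⟩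
  · exact ⟨_, _, _, C.localModel_inc₁ hc⟩

namespace LocalModel

variable {C} {e : OpenPartialHomeomorph C.Pt ℂ} {p : ℂ[X]} {a b : ℂ → ℂ}

theorem deriv_eqn (h : C.LocalModel e p a b) {t : ℂ} (ht : t ∈ e.target) :
    2 * b t * deriv b t = p.derivative.eval (a t) * deriv a t := by
  have h1 : (fun s => b s ^ 2) =ᶠ[𝓝 t] fun s => p.eval (a s) := by
    filter_upwards [e.open_target.mem_nhds ht] with s hs using h.eqn s hs
  have h2 := ((h.analyticAt_snd t ht).differentiableAt.hasDerivAt.pow 2).congr_of_eventuallyEq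
    h1.symm
  have h3 := (p.hasDerivAt (a t)).comp t (h.analyticAt_fst t ht).differentiableAt.hasDerivAt
  simpa using h2.unique h3

/-- The coordinate `a` ramifies exactly over the branch points. This is read off from `2 b b' =
p'(a) a'`, using that `(a, b)` is an immersion and that `p` has simple roots. -/
theorem deriv_fst_eq_zero_iff (h : C.LocalModel e p a b) {t : ℂ} (ht : t ∈ e.target) :
    deriv a t = 0 ↔ b t = 0 := by
  have h1 := h.deriv_eqn ht
  constructor
  · intro h0
    have h2 := (h.immersion t ht).resolve_left (not_not.2 h0)
    rw [h0, mul_zero] at h1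
    simpa [h2] using h1
  · intro h0
    have h2 := h.nonsingular (a t) (by rw [← h.eqn t ht, h0]; simp)
    rw [h0, mul_zero, zero_mul, eq_comm] at h1
    simpa [h2] using h1

theorem deriv_snd_ne_zero (h : C.LocalModel e p a b) {t : ℂ} (ht : t ∈ e.target)
    (h0 : b t = 0) : deriv b t ≠ 0 :=
  (h.immersion t ht).resolve_left (not_not.2 ((h.deriv_fst_eq_zero_iff ht).2 h0))

theorem formCoeff_ne_zero (h : C.LocalModel e p a b) {t : ℂ} (ht : t ∈ e.target) :
    formCoeff p (fun s => (a s, b s)) t ≠ 0 := by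
  by_cases h0 : b t = 0
  · rw [formCoeff_of_eq h0]
    exact div_ne_zero (mul_ne_zero two_ne_zero (h.deriv_snd_ne_zero ht h0))
      (h.nonsingular (a t) (by rw [← h.eqn t ht, h0]; simp))
  · rw [formCoeff_of_ne h0]
    exact div_ne_zero ((h.deriv_fst_eq_zero_iff ht).not.2 h0) h0

theorem conformalFactor_pos (h : C.LocalModel e p a b) {t : ℂ} (ht : t ∈ e.target) :
    0 < C.conformalFactor e t := by
  rw [h.conformalFactor_eq t ht]
  have := norm_pos_iff.2 (h.formCoeff_ne_zero ht)
  positivity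

/-- Near a zero of `b`, the relation `2 b b' = p'(a) a'` makes both branches of `formCoeff` equal to
`2 b' / p'(a)`, which is continuous since `p'(a) ≠ 0` there. -/
theorem continuousAt_formCoeff (h : C.LocalModel e p a b) {t : ℂ} (ht : t ∈ e.target) :
    ContinuousAt (formCoeff p fun s => (a s, b s)) t := by
  have ca := (h.analyticAt_fst t ht).continuousAt
  have cb := (h.analyticAt_snd t ht).continuousAt
  by_cases h0 : b t = 0
  · have hp : p.derivative.eval (a t) ≠ 0 :=
      h.nonsingular (a t) (by rw [← h.eqn t ht, h0]; simp)
    have cp : ContinuousAt (fun s => p.derivative.eval (a s)) t :=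
      p.derivative.continuous.continuousAt.comp ca
    have h1 : (formCoeff p fun s => (a s, b s)) =ᶠ[𝓝 t]
        fun s => 2 * deriv b s / p.derivative.eval (a s) := by
      filter_upwards [e.open_target.mem_nhds ht, cp.eventually_ne hp] with s hs hps
      by_cases hbs : b s = 0
      · rw [formCoeff_of_eq hbs]
      · rw [formCoeff_of_ne hbs]
        have := h.deriv_eqn hs
        simp only
        field_simp
        linear_combination -this
    refine ContinuousAt.congr ?_ h1.symm
    exact (continuousAt_const.mul (h.analyticAt_snd t ht).deriv.continuousAt).div cp hp
  · have h1 : (formCoeff p fun s => (a s, b s)) =ᶠ[𝓝 t] fun s => deriv a s / b s := by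
      filter_upwards [cb.eventually_ne h0] with s hs
      rw [formCoeff_of_ne hs]
    exact ((h.analyticAt_fst t ht).deriv.continuousAt.div cb h0).congr h1.symm

theorem continuousOn_conformalFactor (h : C.LocalModel e p a b) :
    ContinuousOn (C.conformalFactor e) e.target := by
  refine ContinuousOn.congr (fun t ht => ?_) h.conformalFactor_eq
  have ca := (h.analyticAt_fst t ht).continuousAt
  exact (((h.continuousAt_formCoeff ht).norm.pow 2).mul
    (continuousAt_const.add (ca.norm.pow 2))).continuousWithinAt

/-- The density of the branch divisor is the spherical density. -/
theorem prod_F_mul_conformalFactor (h : C.LocalModel e p a b) {P : Fin 6 → C.Pt}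
    (hP : Function.Injective P) (hPW : range P = C.weierstrassPoints) {t : ℂ}
    (ht : t ∈ e.target) :
    (∏ i, C.F (P i) (e.symm t)) * C.conformalFactor e t =
      ‖deriv a t‖ ^ 2 / (1 + ‖a t‖ ^ 2) ^ 2 := by
  rw [h.prod_F P hP hPW t ht, h.conformalFactor_eq t ht]
  -- At a branch point both sides vanish, the left because `b = 0` and the right because `a' = 0`.
  by_cases h0 : b t = 0
  · rw [(h.deriv_fst_eq_zero_iff ht).2 h0, h0]; simp
  · rw [formCoeff_of_ne h0, norm_div]
    have : 0 < ‖b t‖ := norm_pos_iff.2 h0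
    field_simp

end LocalModel

end GenusTwoCurve

namespace GenusTwoCurve

variable (C : GenusTwoCurve)

open Filter Topology

/-! ### The curve is compact and Hausdorff -/

section Topology

theorem isClosed_affine (p : ℂ[X]) : IsClosed {q : ℂ × ℂ | q.2 ^ 2 = p.eval q.1} :=
  isClosed_eq (by fun_prop) (p.continuous.comp continuous_fst)

/-- Over the closed unit disc the second coordinate is bounded by `|y|² = |p(x)|`, and the affine
curve is closed in `ℂ × ℂ`. -/
theorem isCompact_affine_norm_le_one (p : ℂ[X]) : IsCompact {q : AffineCurve p | ‖q.1.1‖ ≤ 1} := by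
  rw [Topology.IsEmbedding.subtypeVal.isCompact_iff]
  obtain ⟨M, hM⟩ := (isCompact_closedBall (0 : ℂ) 1).exists_bound_of_continuousOn
    p.continuous.continuousOn
  refine Metric.isCompact_of_isClosed_isBounded ?_ ?_
  · have : Subtype.val '' {q : AffineCurve p | ‖q.1.1‖ ≤ 1} =
        {q : ℂ × ℂ | q.2 ^ 2 = p.eval q.1} ∩ {q | ‖q.1‖ ≤ 1} := by
      ext q
      constructor
      · rintro ⟨q, hq, rfl⟩; exact ⟨q.2, hq⟩
      · rintro ⟨h1, h2⟩; exact ⟨⟨q, h1⟩, h2, rfl⟩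
    rw [this]
    exact (isClosed_affine p).inter (isClosed_le (by fun_prop) continuous_const)
  · refine (Metric.isBounded_closedBall (x := (0 : ℂ × ℂ)) (r := max 1 (M + 1))).subset ?_
    rintro _ ⟨q, hq, rfl⟩
    rw [mem_closedBall_zero_iff, Prod.norm_def]
    refine max_le_max hq ?_
    have h1 : ‖q.1.2‖ ^ 2 ≤ M := by
      rw [← norm_pow, q.2]
      exact hM _ (by simpa using hq)
    nlinarith [sq_nonneg (‖q.1.2‖ - 1)]

/-- The compact pieces `|x| ≤ 1` and `|z| ≤ 1` cover the curve, as `z = 1/x`. -/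
instance : CompactSpace C.Pt := by
  refine ⟨?_⟩
  have h0 := (isCompact_affine_norm_le_one C.f).image C.isOpenEmbedding_inc₀.continuous
  have h1 := (isCompact_affine_norm_le_one C.g).image C.isOpenEmbedding_inc₁.continuous
  convert h0.union h1
  refine (eq_univ_of_forall fun P => ?_).symm
  obtain ⟨a, rfl⟩ | ⟨b, rfl⟩ := C.exists_rep P
  · by_cases h : ‖a.1.1‖ ≤ 1
    · exact Or.inl ⟨a, h, rfl⟩
    · have h0 : a.1.1 ≠ 0 := fun h0 => h (by simp [h0])
      right
      refine ⟨⟨(a.1.1⁻¹, a.1.2 / a.1.1 ^ 3), ?_⟩, ?_, ?_⟩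
      · change (a.1.2 / a.1.1 ^ 3) ^ 2 = C.g.eval a.1.1⁻¹
        rw [C.g_eval _ h0, ← a.2]; field_simp
      · change ‖a.1.1⁻¹‖ ≤ 1
        rw [norm_inv]
        exact inv_le_one_of_one_le₀ (not_le.1 h).le
      · exact ((C.inc₀_eq_inc₁ a _).2 ⟨h0, rfl, rfl⟩).symm
  · by_cases h : ‖b.1.1‖ ≤ 1
    · exact Or.inr ⟨b, h, rfl⟩
    · have h0 : b.1.1 ≠ 0 := fun h0 => h (by simp [h0])
      left
      obtain ⟨a, ha⟩ := (C.inc₁_mem_range_inc₀ b).2 h0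
      refine ⟨a, ?_, ha⟩
      obtain ⟨h1, h2, -⟩ := (C.inc₀_eq_inc₁ a b).1 ha
      rw [h2, norm_inv, not_le] at h
      by_contra h3
      exact absurd h (not_lt.2 (inv_le_one_of_one_le₀ (not_le.1 h3).le))

/-- Two points of the same affine piece are separated there. For a finite point `a` and a point at
infinity, the sets `|x| < |x(a)| + 1` and `|z| < 1 / (|x(a)| + 1)` are disjoint. -/
instance : T2Space C.Pt := by
  have h01 : ∀ (a : C.C₀) (b : C.C₁), b.1.1 = 0 → ∃ U V : Set C.Pt, IsOpen U ∧ IsOpen V ∧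
      C.inc₀ a ∈ U ∧ C.inc₁ b ∈ V ∧ Disjoint U V := by
    intro a b hb
    refine ⟨C.inc₀ '' {q | ‖q.1.1‖ < ‖a.1.1‖ + 1}, C.inc₁ '' {q | ‖q.1.1‖ < (‖a.1.1‖ + 1)⁻¹},
      C.isOpenEmbedding_inc₀.isOpenMap _ (isOpen_lt (by fun_prop) (by fun_prop)),
      C.isOpenEmbedding_inc₁.isOpenMap _ (isOpen_lt (by fun_prop) (by fun_prop)),
      ⟨a, by simp, rfl⟩, ⟨b, by simp [hb]; positivity, rfl⟩, ?_⟩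
    rw [Set.disjoint_left]
    rintro _ ⟨q, hq, rfl⟩ ⟨r, hr, h⟩
    obtain ⟨h1, h2, -⟩ := (C.inc₀_eq_inc₁ q r).1 h.symm
    simp only [mem_ofPred_eq] at hq hr
    rw [h2, norm_inv, inv_lt_inv₀ (norm_pos_iff.2 h1) (by positivity)] at hr
    exact absurd hq (not_lt.2 hr.le)
  refine ⟨fun P Q hPQ => ?_⟩
  obtain ⟨a, rfl⟩ | ⟨-, b, hb, rfl⟩ := C.exists_rep_finite_or_infinite P
  · obtain ⟨a', rfl⟩ | ⟨-, b', hb', rfl⟩ := C.exists_rep_finite_or_infinite Q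
    · obtain ⟨U, V, hU, hV, ha, ha', hd⟩ := t2_separation (show a ≠ a' from fun h => hPQ (h ▸ rfl))
      exact ⟨_, _, C.isOpenEmbedding_inc₀.isOpenMap U hU, C.isOpenEmbedding_inc₀.isOpenMap V hV,
        ⟨a, ha, rfl⟩, ⟨a', ha', rfl⟩, (disjoint_image_iff C.inc₀_injective).2 hd⟩
    · exact h01 a b' hb'
  · obtain ⟨a', rfl⟩ | ⟨-, b', hb', rfl⟩ := C.exists_rep_finite_or_infinite Q
    · obtain ⟨U, V, hU, hV, h1, h2, h3⟩ := h01 a' b hb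
      exact ⟨V, U, hV, hU, h2, h1, h3.symm⟩
    · obtain ⟨U, V, hU, hV, ha, ha', hd⟩ := t2_separation (show b ≠ b' from fun h => hPQ (h ▸ rfl))
      exact ⟨_, _, C.isOpenEmbedding_inc₁.isOpenMap U hU, C.isOpenEmbedding_inc₁.isOpenMap V hV,
        ⟨b, ha, rfl⟩, ⟨b', ha', rfl⟩, (disjoint_image_iff C.inc₁_injective).2 hd⟩

end Topology

/-! ### Holomorphic one-forms and the metric under change of chart -/

section Transition

variable {C} {e e' : OpenPartialHomeomorph C.Pt ℂ}

/-- Both branches of `formCoeff` are linear in a first derivative, so the chain rule supplies `τ'`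
in each; which branch applies depends only on the point of the curve. -/
theorem formCoeff_comp {p : ℂ[X]} {γ₁ γ₂ : ℂ → ℂ × ℂ} {τ : ℂ → ℂ} {t : ℂ}
    (h : γ₁ =ᶠ[𝓝 t] γ₂ ∘ τ) (hγ : DifferentiableAt ℂ γ₂ (τ t)) (hτ : DifferentiableAt ℂ τ t) :
    formCoeff p γ₁ t = deriv τ t * formCoeff p γ₂ (τ t) := by
  have h0 : γ₁ t = γ₂ (τ t) := h.eq_of_nhds
  have h1 : deriv (fun s => (γ₁ s).1) t = deriv (fun s => (γ₂ s).1) (τ t) * deriv τ t := by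
    have : (fun s => (γ₁ s).1) =ᶠ[𝓝 t] (fun s => (γ₂ s).1) ∘ τ := by
      filter_upwards [h] with s hs
      rw [hs]; rfl
    rw [this.deriv_eq, deriv_comp t hγ.fst hτ]
  have h2 : deriv (fun s => (γ₁ s).2) t = deriv (fun s => (γ₂ s).2) (τ t) * deriv τ t := by
    have : (fun s => (γ₁ s).2) =ᶠ[𝓝 t] (fun s => (γ₂ s).2) ∘ τ := by
      filter_upwards [h] with s hs
      rw [hs]; rfl
    rw [this.deriv_eq, deriv_comp t hγ.snd hτ]
  by_cases hz : (γ₂ (τ t)).2 = 0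
  · rw [formCoeff_of_eq (h0 ▸ hz), formCoeff_of_eq hz, h0, h2]; ring
  · rw [formCoeff_of_ne (h0 ▸ hz), formCoeff_of_ne hz, h0, h1]; ring

theorem differentiableAt_coords₀ (he : e ∈ C.charts) {t : ℂ} (ht : t ∈ e.target)
    (hr : e.symm t ∈ range C.inc₀) : DifferentiableAt ℂ (fun s => C.coords₀ (e.symm s)) t := by
  rcases he with ⟨c, hc, rfl⟩ | ⟨c, hc, rfl⟩
  · exact (hc.2.contDiffAt (c.open_target.mem_nhds ht)).differentiableAt (by simp)
  · have h := (hc.2.contDiffAt (c.open_target.mem_nhds ht)).differentiableAt (by simp)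
    have h0 : (c.symm t).1.1 ≠ 0 := (C.inc₁_mem_range_inc₀ (c.symm t)).1 hr
    exact (h.fst.fun_inv h0).prodMk (h.snd.fun_div (h.fst.fun_pow 3) (pow_ne_zero _ h0))

theorem differentiableAt_coords₁ (he : e ∈ C.charts) {t : ℂ} (ht : t ∈ e.target)
    (hr : e.symm t ∉ range C.inc₀) : DifferentiableAt ℂ (fun s => C.coords₁ (e.symm s)) t := by
  rcases he with ⟨c, hc, rfl⟩ | ⟨c, hc, rfl⟩
  · exact absurd ⟨c.symm t, rfl⟩ hr
  · exact (hc.2.contDiffAt (c.open_target.mem_nhds ht)).differentiableAt (by simp)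

theorem analyticAt_transition (he : e ∈ C.charts) (he' : e' ∈ C.charts) {t : ℂ}
    (ht : t ∈ (e.symm ≫ₕ e').source) : AnalyticAt ℂ (e.symm ≫ₕ e') t :=
  ((C.charts_compatible he he').contDiffAt
    ((e.symm ≫ₕ e').open_source.mem_nhds ht)).analyticAt

theorem symm_transition {t : ℂ} (ht : t ∈ (e.symm ≫ₕ e').source) :
    e'.symm ((e.symm ≫ₕ e') t) = e.symm t :=
  e'.left_inv ht.2

theorem transition_mem_target {t : ℂ} (ht : t ∈ (e.symm ≫ₕ e').source) :
    (e.symm ≫ₕ e') t ∈ e'.target :=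
  e'.map_source ht.2

theorem holForm_transition (he : e ∈ C.charts) (he' : e' ∈ C.charts) {t : ℂ}
    (ht : t ∈ (e.symm ≫ₕ e').source) (i : Fin 2) :
    C.holForm e t i = deriv (e.symm ≫ₕ e') t * C.holForm e' ((e.symm ≫ₕ e') t) i := by
  have hτ := (analyticAt_transition he he' ht).differentiableAt
  have ht' := transition_mem_target ht
  have hs := symm_transition ht
  have hev : ∀ {M : Type} (k : C.Pt → M),
      (fun s => k (e.symm s)) =ᶠ[𝓝 t] (fun s => k (e'.symm s)) ∘ (e.symm ≫ₕ e') := by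
    intro M k
    filter_upwards [(e.symm ≫ₕ e').open_source.mem_nhds ht] with s hs
    exact congrArg k (symm_transition hs).symm
  rw [holForm, holForm, hs]
  split_ifs with h
  · have := formCoeff_comp (p := C.f) (hev C.coords₀)
      (differentiableAt_coords₀ he' ht' (hs ▸ h)) hτ
    fin_cases i
    · simpa using this
    · simp only [Fin.mk_one, Matrix.cons_val_one, this]
      simp
      ring
  · have := formCoeff_comp (p := C.g) (hev C.coords₁)
      (differentiableAt_coords₁ he' ht' (hs ▸ h)) hτ
    fin_cases i
    · simp [this]
      ring
    · simp [this]

theorem conformalFactor_transition (he : e ∈ C.charts) (he' : e' ∈ C.charts) {t : ℂ}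
    (ht : t ∈ (e.symm ≫ₕ e').source) :
    C.conformalFactor e t =
      ‖deriv (e.symm ≫ₕ e') t‖ ^ 2 * C.conformalFactor e' ((e.symm ≫ₕ e') t) := by
  simp only [conformalFactor, holForm_transition he he' ht, norm_mul, mul_pow, Finset.mul_sum]

theorem continuousOn_conformalFactor (he : e ∈ C.charts) :
    ContinuousOn (C.conformalFactor e) e.target := by
  obtain ⟨p, a, b, h⟩ := C.exists_localModel he
  exact h.continuousOn_conformalFactor

theorem conformalFactor_pos (he : e ∈ C.charts) {t : ℂ} (ht : t ∈ e.target) :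
    0 < C.conformalFactor e t := by
  obtain ⟨p, a, b, h⟩ := C.exists_localModel he
  exact h.conformalFactor_pos ht

/-- A zero of `τ'` would make `ρ = |τ'|² ρ'` vanish, but conformal factors are positive. -/
theorem deriv_transition_ne_zero (he : e ∈ C.charts) (he' : e' ∈ C.charts) {t : ℂ}
    (ht : t ∈ (e.symm ≫ₕ e').source) : deriv (e.symm ≫ₕ e') t ≠ 0 := by
  intro h
  have h1 := conformalFactor_transition he he' ht
  have h2 := conformalFactor_pos he ht.1
  rw [h] at h1
  simp [h1] at h2

end Transition

/-! ### The area measure restricts to the measure of each chart -/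

section Area

variable {C} {e e' : OpenPartialHomeomorph C.Pt ℂ}

/-- The area measure of a chart. -/
def chartArea (C : GenusTwoCurve) (e : OpenPartialHomeomorph C.Pt ℂ) : Measure C.Pt :=
  Measure.map e.symm
    ((volume.restrict e.target).withDensity fun t => ENNReal.ofReal (C.conformalFactor e t))

theorem area_eq_sSup : C.area = sSup (C.chartArea '' C.charts) := by
  rw [sSup_image]; rfl

theorem aemeasurable_symm (e : OpenPartialHomeomorph C.Pt ℂ) :
    AEMeasurable e.symm
      ((volume.restrict e.target).withDensity fun t => ENNReal.ofReal (C.conformalFactor e t)) :=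
  (e.continuousOn_symm.aemeasurable e.open_target.measurableSet).mono_ac
    (withDensity_absolutelyContinuous _ _)

theorem measurableSet_target_inter_preimage (e : OpenPartialHomeomorph C.Pt ℂ) {A : Set C.Pt}
    (hA : MeasurableSet A) : MeasurableSet (e.target ∩ e.symm ⁻¹' A) := by
  have h : Measurable (fun t : e.target => e.symm t) :=
    (continuousOn_iff_continuous_domRestrict.1 e.continuousOn_symm).measurable
  have := e.open_target.measurableSet.subtype_image (h hA)
  convert this using 1
  ext t
  constructor
  · rintro ⟨h1, h2⟩; exact ⟨⟨t, h1⟩, h2, rfl⟩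
  · rintro ⟨t, h2, rfl⟩; exact ⟨t.2, h2⟩

theorem chartArea_apply (e : OpenPartialHomeomorph C.Pt ℂ) {A : Set C.Pt} (hA : MeasurableSet A) :
    C.chartArea e A =
      ∫⁻ t in e.target ∩ e.symm ⁻¹' A, ENNReal.ofReal (C.conformalFactor e t) := by
  rw [chartArea, Measure.map_apply_of_aemeasurable (aemeasurable_symm e) hA, withDensity_apply',
    Measure.restrict_restrict' e.open_target.measurableSet, inter_comm]

theorem det_fderiv_real {τ : ℂ → ℂ} {t : ℂ} (hτ : DifferentiableAt ℂ τ t) :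
    (fderiv ℝ τ t).det = ‖deriv τ t‖ ^ 2 := by
  rw [hτ.fderiv_restrictScalars ℝ]
  simp [ContinuousLinearMap.det, LinearMap.det_restrictScalars,
    Algebra.norm_complex_eq, Complex.normSq_eq_norm_sq]

/-- Change of variables along the transition `τ`: its real Jacobian determinant is `|τ'|²`, which is
exactly the ratio of the conformal factors. -/
theorem chartArea_eq_of_subset (he : e ∈ C.charts) (he' : e' ∈ C.charts) {A : Set C.Pt}
    (hA : MeasurableSet A) (h : A ⊆ e.source) (h' : A ⊆ e'.source) :
    C.chartArea e A = C.chartArea e' A := by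
  have hs : ∀ t ∈ e.target ∩ e.symm ⁻¹' A, t ∈ (e.symm ≫ₕ e').source := fun t ht =>
    ⟨ht.1, h' ht.2⟩
  have himg : (e.symm ≫ₕ e') '' (e.target ∩ e.symm ⁻¹' A) = e'.target ∩ e'.symm ⁻¹' A := by
    ext t
    constructor
    · rintro ⟨s, hsA, rfl⟩
      refine ⟨transition_mem_target (hs s hsA), ?_⟩
      rw [mem_preimage, symm_transition (hs s hsA)]
      exact hsA.2
    · rintro ⟨h1, h2⟩
      refine ⟨e (e'.symm t), ⟨e.map_source (h h2), ?_⟩, ?_⟩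
      · rw [mem_preimage, e.left_inv (h h2)]; exact h2
      · change e' (e.symm (e (e'.symm t))) = t
        rw [e.left_inv (h h2), e'.right_inv h1]
  rw [chartArea_apply e hA, chartArea_apply e' hA, ← himg,
    lintegral_image_eq_lintegral_abs_det_fderiv_mul volume
      (measurableSet_target_inter_preimage e hA)
      (fun t ht => ((analyticAt_transition he he' (hs t ht)).differentiableAt.restrictScalars
        ℝ).hasFDerivAt.hasFDerivWithinAt)
      ((e.symm ≫ₕ e').injOn.mono hs)]
  refine setLIntegral_congr_fun (measurableSet_target_inter_preimage e hA) fun t ht => ?_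
  have hd := (analyticAt_transition he he' (hs t ht)).differentiableAt
  rw [conformalFactor_transition he he' (hs t ht), det_fderiv_real hd,
    ENNReal.ofReal_mul (by positivity), abs_of_nonneg (by positivity)]

theorem chartArea_compl_source (e : OpenPartialHomeomorph C.Pt ℂ) :
    C.chartArea e e.sourceᶜ = 0 := by
  rw [chartArea_apply e e.open_source.measurableSet.compl]
  have : e.target ∩ e.symm ⁻¹' e.sourceᶜ = ∅ := by
    ext t
    simp only [mem_inter_iff, mem_preimage, mem_compl_iff, mem_empty_iff_false, iff_false,
      not_and, not_not]
    exact fun ht => e.map_target ht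
  rw [this, Measure.restrict_empty, lintegral_zero_measure]

/-- An upper bound common to all chart measures, made infinite off `e.source` so that nothing has to
be known there, and still sharp on `e.source`. It controls the supremum from above. -/
theorem chartArea_le (he : e ∈ C.charts) (he' : e' ∈ C.charts) :
    C.chartArea e' ≤ C.chartArea e + (⊤ : Measure C.Pt).restrict e.sourceᶜ := by
  refine Measure.le_iff.2 fun A hA => ?_
  have hm : MeasurableSet (A ∩ e.source ∩ e'.source) :=
    (hA.inter e.open_source.measurableSet).inter e'.open_source.measurableSet
  have h1 : C.chartArea e' (A ∩ e.source) ≤ C.chartArea e A := by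
    calc C.chartArea e' (A ∩ e.source)
        ≤ C.chartArea e' (A ∩ e.source ∩ e'.source) + C.chartArea e' e'.sourceᶜ := by
          refine (measure_mono fun x hx => ?_).trans (measure_union_le _ _)
          by_cases h : x ∈ e'.source
          · exact Or.inl ⟨hx, h⟩
          · exact Or.inr h
      _ = C.chartArea e (A ∩ e.source ∩ e'.source) := by
          rw [chartArea_compl_source, add_zero]
          exact chartArea_eq_of_subset he' he hm inter_subset_right
            (inter_subset_left.trans inter_subset_right)
      _ ≤ C.chartArea e A := measure_mono (inter_subset_left.trans inter_subset_left)
  rw [Measure.add_apply, Measure.restrict_apply hA,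
    ← measure_inter_add_sdiff A e.open_source.measurableSet]
  exact add_le_add h1 ((le_top : C.chartArea e' ≤ ⊤) _)

/-- The bound of `chartArea_le` passes to the supremum and loses its infinite part on `e.source`;
conversely the chart measure is one of the terms of the supremum and is carried by `e.source`. -/
theorem area_restrict_source (he : e ∈ C.charts) : C.area.restrict e.source = C.chartArea e := by
  refine le_antisymm ?_ ?_
  · have hle : C.area ≤ C.chartArea e + (⊤ : Measure C.Pt).restrict e.sourceᶜ := by
      rw [area_eq_sSup]
      refine sSup_le ?_
      rintro _ ⟨e', he', rfl⟩
      exact chartArea_le he he'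
    refine Measure.le_iff.2 fun A hA => ?_
    rw [Measure.restrict_apply hA]
    refine (hle _).trans ?_
    rw [Measure.add_apply, Measure.restrict_apply (hA.inter e.open_source.measurableSet),
      inter_assoc, inter_compl_self, inter_empty, measure_empty, add_zero]
    exact measure_mono inter_subset_left
  · have h1 : C.chartArea e ≤ C.area := by
      rw [area_eq_sSup]; exact le_sSup (mem_image_of_mem _ he)
    refine Measure.le_iff.2 fun A hA => ?_
    rw [Measure.restrict_apply hA]
    calc C.chartArea e A ≤ C.chartArea e (A ∩ e.source) + C.chartArea e e.sourceᶜ := by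
          refine (measure_mono fun x hx => ?_).trans (measure_union_le _ _)
          by_cases h : x ∈ e.source
          · exact Or.inl ⟨hx, h⟩
          · exact Or.inr h
      _ ≤ C.area (A ∩ e.source) := by
          rw [chartArea_compl_source, add_zero]; exact h1 _

end Area

end GenusTwoCurve

namespace GenusTwoCurve

variable {C : GenusTwoCurve} {e : OpenPartialHomeomorph C.Pt ℂ}

open Filter Topology Laplacian

theorem chartAt_mem_charts (P : C.Pt) : chartAt ℂ P ∈ C.charts := chart_mem_atlas ℂ P

/-! ### The Laplace-Beltrami operator in charts -/

section Calculus

theorem mem_maximalAtlas (he : e ∈ C.charts) :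
    e ∈ IsManifold.maximalAtlas 𝓘(ℝ, ℂ) ∞ C.Pt :=
  IsManifold.subset_maximalAtlas he

theorem contDiffOn_comp_symm {φ : C.Pt → ℝ} (hφ : ContMDiff 𝓘(ℝ, ℂ) 𝓘(ℝ, ℝ) ∞ φ)
    (he : e ∈ C.charts) : ContDiffOn ℝ ∞ (fun t => φ (e.symm t)) e.target := by
  rw [← contMDiffOn_iff_contDiffOn]
  exact hφ.comp_contMDiffOn (contMDiffOn_symm_of_mem_maximalAtlas (mem_maximalAtlas he))

theorem contMDiffAt_of_comp_symm {φ : C.Pt → ℝ} (he : e ∈ C.charts) {P : C.Pt}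
    (hP : P ∈ e.source) (hφ : ContDiffAt ℝ ∞ (fun t => φ (e.symm t)) (e P)) :
    ContMDiffAt 𝓘(ℝ, ℂ) 𝓘(ℝ, ℝ) ∞ φ P := by
  have h1 : ContMDiffAt 𝓘(ℝ, ℂ) 𝓘(ℝ, ℂ) ∞ e P :=
    contMDiffAt_of_mem_maximalAtlas (mem_maximalAtlas he) hP
  have h2 := hφ.contMDiffAt.comp P h1
  refine h2.congr_of_eventuallyEq ?_
  filter_upwards [e.open_source.mem_nhds hP] with Q hQ
  simp [e.left_inv hQ]

theorem continuousAt_of_comp_symm {X : Type*} [TopologicalSpace X] {G : C.Pt → X} {P : C.Pt}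
    (hP : P ∈ e.source) (hG : ContinuousAt (fun t => G (e.symm t)) (e P)) : ContinuousAt G P := by
  refine ContinuousAt.congr (hG.comp (e.continuousAt hP)) ?_
  filter_upwards [e.open_source.mem_nhds hP] with Q hQ
  simp [e.left_inv hQ]

/-- The plane Laplacian and the conformal factor both acquire `|τ'|²`, which cancels in the
quotient. -/
theorem laplacian_transition {e' : OpenPartialHomeomorph C.Pt ℂ} {φ : C.Pt → ℝ}
    (hφ : ContMDiff 𝓘(ℝ, ℂ) 𝓘(ℝ, ℝ) ∞ φ) (he : e ∈ C.charts) (he' : e' ∈ C.charts) {t : ℂ}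
    (ht : t ∈ (e.symm ≫ₕ e').source) :
    (C.conformalFactor e' ((e.symm ≫ₕ e') t))⁻¹ *
        (Δ fun s => φ (e'.symm s)) ((e.symm ≫ₕ e') t) =
      (C.conformalFactor e t)⁻¹ * (Δ fun s => φ (e.symm s)) t := by
  have ht' := transition_mem_target ht
  have h1 : (fun s => φ (e.symm s)) =ᶠ[𝓝 t] fun s => φ (e'.symm ((e.symm ≫ₕ e') s)) := by
    filter_upwards [(e.symm ≫ₕ e').open_source.mem_nhds ht] with s hs
    rw [symm_transition hs]
  have h2 := laplacian_comp_analytic (analyticAt_transition he he' ht)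
    (((contDiffOn_comp_symm hφ he').contDiffAt (e'.open_target.mem_nhds ht')).of_le
      (by norm_cast))
  rw [(InnerProductSpace.laplacian_congr_nhds h1).eq_of_nhds, h2,
    conformalFactor_transition he he' ht]
  have := norm_pos_iff.2 (deriv_transition_ne_zero he he' ht)
  have := conformalFactor_pos he' ht'
  field_simp

/-- The Laplace-Beltrami operator may be computed in any chart. -/
theorem laplacian_eq {φ : C.Pt → ℝ} (hφ : ContMDiff 𝓘(ℝ, ℂ) 𝓘(ℝ, ℝ) ∞ φ) (he : e ∈ C.charts)
    {t : ℂ} (ht : t ∈ e.target) :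
    C.laplacian φ (e.symm t) =
      (C.conformalFactor e t)⁻¹ * (Δ fun s => φ (e.symm s)) t :=
  laplacian_transition hφ he (chartAt_mem_charts _) ⟨ht, mem_chart_source ℂ (e.symm t)⟩

/-- The definition evaluates in `chartAt ℂ P`, which may jump with `P`; near a given point the
operator is computed in one fixed chart instead. -/
theorem continuous_laplacian {φ : C.Pt → ℝ} (hφ : ContMDiff 𝓘(ℝ, ℂ) 𝓘(ℝ, ℝ) ∞ φ) :
    Continuous (C.laplacian φ) := by
  rw [continuous_iff_continuousAt]
  intro P
  have he := chartAt_mem_charts P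
  have hP := mem_chart_source ℂ P
  have ht := (chartAt ℂ P).map_source hP
  refine continuousAt_of_comp_symm hP ?_
  refine ContinuousOn.continuousAt (s := (chartAt ℂ P).target) ?_
    ((chartAt ℂ P).open_target.mem_nhds ht)
  refine ContinuousOn.congr ?_ fun t ht => laplacian_eq hφ he ht
  exact ((continuousOn_conformalFactor he).inv₀ fun t ht => (conformalFactor_pos he ht).ne').mul
    (continuousOn_laplacian (chartAt ℂ P).open_target (contDiffOn_comp_symm hφ he))

theorem laplacian_sum {ι : Type*} (s : Finset ι) {φ : ι → C.Pt → ℝ}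
    (hφ : ∀ i ∈ s, ContMDiff 𝓘(ℝ, ℂ) 𝓘(ℝ, ℝ) ∞ (φ i)) (P : C.Pt) :
    C.laplacian (fun Q => ∑ i ∈ s, φ i Q) P = ∑ i ∈ s, C.laplacian (φ i) P := by
  classical
  have he := chartAt_mem_charts P
  have ht := (chartAt ℂ P).map_source (mem_chart_source ℂ P)
  have hd : ∀ i ∈ s, ContDiffAt ℝ 2 (fun t => φ i ((chartAt ℂ P).symm t)) (chartAt ℂ P P) :=
    fun i hi => ((contDiffOn_comp_symm (hφ i hi) he).contDiffAt
      ((chartAt ℂ P).open_target.mem_nhds ht)).of_le (by norm_cast)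
  simp only [laplacian]
  rw [← Finset.mul_sum]
  congr 1
  clear hφ
  induction s using Finset.induction_on with
  | empty => simp
  | insert i s hi ih =>
    simp only [Finset.sum_insert hi]
    rw [← ih fun j hj => hd j (Finset.mem_insert_of_mem hj)]
    exact (hd i (Finset.mem_insert_self i s)).laplacian_add
      (ContDiffAt.sum fun j hj => hd j (Finset.mem_insert_of_mem hj))

end Calculus

/-! ### Integration over the curve in charts -/

section Integration

theorem aemeasurable_conformalFactor (he : e ∈ C.charts) :
    AEMeasurable (C.conformalFactor e) (volume.restrict e.target) :=
  (continuousOn_conformalFactor he).aemeasurable e.open_target.measurableSet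

theorem integrableOn_source_iff (he : e ∈ C.charts) {G : C.Pt → ℝ} (hG : Measurable G) :
    IntegrableOn G e.source C.area ↔
      IntegrableOn (fun t => C.conformalFactor e t * G (e.symm t)) e.target := by
  rw [IntegrableOn, area_restrict_source he, chartArea,
    integrable_map_measure hG.aestronglyMeasurable (aemeasurable_symm e)]
  simp only [ENNReal.ofReal]
  rw [integrable_withDensity_iff_integrable_smul₀ (aemeasurable_conformalFactor he).real_toNNReal]
  refine integrable_congr ?_
  filter_upwards [ae_restrict_mem e.open_target.measurableSet] with t ht
  simp [NNReal.smul_def, (conformalFactor_pos he ht).le]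

theorem setIntegral_source (he : e ∈ C.charts) {G : C.Pt → ℝ} (hG : Measurable G) :
    ∫ Q in e.source, G Q ∂C.area =
      ∫ t in e.target, C.conformalFactor e t * G (e.symm t) := by
  rw [area_restrict_source he, chartArea,
    integral_map (aemeasurable_symm e) hG.aestronglyMeasurable]
  simp only [ENNReal.ofReal]
  rw [integral_withDensity_eq_integral_smul₀ (aemeasurable_conformalFactor he).real_toNNReal]
  refine integral_congr_ae ?_
  filter_upwards [ae_restrict_mem e.open_target.measurableSet] with t ht
  simp [NNReal.smul_def, (conformalFactor_pos he ht).le]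

instance : NullSingletonClass C.area := by
  refine ⟨fun P => ?_⟩
  obtain ⟨e, he, hP⟩ := C.exists_chart P
  have h1 : C.area {P} = C.chartArea e {P} := by
    rw [← area_restrict_source he, Measure.restrict_apply (measurableSet_singleton P),
      inter_eq_left.2 (singleton_subset_iff.2 hP)]
  rw [h1, chartArea_apply _ (measurableSet_singleton P)]
  refine setLIntegral_measure_zero _ _ (measure_mono_null (t := {e P}) ?_ (by simp))
  rintro t ⟨ht, htP⟩
  rw [mem_preimage, mem_singleton_iff] at htP
  rw [mem_singleton_iff, ← htP, e.right_inv ht]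

/-- Integrability near a point may be tested in a chart. -/
theorem integrableAtFilter_of_chart (he : e ∈ C.charts) {P : C.Pt} (hP : P ∈ e.source)
    {G : C.Pt → ℝ} (hG : Measurable G)
    (h : IntegrableAtFilter (fun t => G (e.symm t)) (𝓝 (e P)) volume) :
    IntegrableAtFilter G (𝓝 P) C.area := by
  obtain ⟨s, hs, hi⟩ := h
  -- On a compact neighbourhood inside the target the continuous factor `ρ` is bounded, so
  -- multiplying by it preserves integrability.
  obtain ⟨K, hK, hKs, hKc⟩ := local_compact_nhds
    (inter_mem hs (e.open_target.mem_nhds (e.map_source hP)))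
  obtain ⟨U, hUK, hU, hPU⟩ := mem_nhds_iff.1 hK
  set A := e.source ∩ e ⁻¹' U with hA
  have hAo : IsOpen A := e.isOpen_inter_preimage hU
  refine ⟨A, hAo.mem_nhds ⟨hP, hPU⟩, ?_⟩
  -- Cutting `G` off outside `A` reduces the claim to the whole chart domain, where the transfer to
  -- the plane is available.
  have h1 : IntegrableOn (A.indicator G) e.source C.area := by
    rw [integrableOn_source_iff he (hG.indicator hAo.measurableSet)]
    have h2 : IntegrableOn (fun t => C.conformalFactor e t * G (e.symm t)) K := by
      refine IntegrableOn.continuousOn_mul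
        ((continuousOn_conformalFactor he).mono (hKs.trans inter_subset_right))
        (hi.mono_set (hKs.trans inter_subset_left)) hKc
    have h3 : IntegrableOn (fun t => C.conformalFactor e t * G (e.symm t)) U := h2.mono_set hUK
    have h4 := (h3.integrable_indicator hU.measurableSet).integrableOn (s := e.target)
    refine h4.congr_fun (fun t ht => ?_) e.open_target.measurableSet
    by_cases htU : t ∈ U
    · have hm : e.symm t ∈ A := ⟨e.map_target ht, by rwa [mem_preimage, e.right_inv ht]⟩
      simp only [indicator_of_mem htU, indicator_of_mem hm]
    · have hm : e.symm t ∉ A := fun h => htU (by simpa [e.right_inv ht] using h.2)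
      simp only [indicator_of_notMem htU, indicator_of_notMem hm, mul_zero]
  have h5 : IntegrableOn (A.indicator G) A C.area := h1.mono_set inter_subset_left
  exact h5.congr_fun (fun Q hQ => indicator_of_mem hQ G) hAo.measurableSet

/-- Local integrability suffices because the curve is compact. -/
theorem integrable_of_charts {G : C.Pt → ℝ} (hG : Measurable G)
    (h : ∀ P, ∃ e ∈ C.charts, P ∈ e.source ∧
      IntegrableAtFilter (fun t => G (e.symm t)) (𝓝 (e P)) volume) :
    Integrable G C.area := by
  have : LocallyIntegrable G C.area := fun P => by
    obtain ⟨e, he, hP, hi⟩ := h P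
    exact integrableAtFilter_of_chart he hP hG hi
  rw [← integrableOn_univ]
  exact this.integrableOn_isCompact isCompact_univ

instance : IsFiniteMeasure C.area := by
  have : Integrable (fun _ : C.Pt => (1 : ℝ)) C.area := by
    refine integrable_of_charts measurable_const fun P =>
      ⟨_, chartAt_mem_charts P, mem_chart_source ℂ P, ?_⟩
    exact continuous_const.locallyIntegrable _
  exact (integrable_const_iff_isFiniteMeasure one_ne_zero).1 this

theorem integrable_of_continuous {G : C.Pt → ℝ} (hG : Continuous G) : Integrable G C.area := by
  rw [← integrableOn_univ]
  exact hG.continuousOn.integrableOn_compact isCompact_univ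

end Integration

end GenusTwoCurve

/-! ### The singularities of `log F_R` and its distributional Laplacian -/

theorem AnalyticAt.exists_eq_sub_mul {f : ℂ → ℂ} {z : ℂ} (hf : AnalyticAt ℂ f z) (h0 : f z = 0) :
    ∃ g : ℂ → ℂ, AnalyticAt ℂ g z ∧ g z = deriv f z ∧ ∀ t, f t = (t - z) * g t := by
  obtain ⟨p, hp⟩ := hf
  refine ⟨dslope f z, hp.has_fpower_series_dslope_fslope.analyticAt, dslope_same f z, fun t => ?_⟩
  have := sub_smul_dslope f z t
  rw [h0, sub_zero, smul_eq_mul] at this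
  exact this.symm

namespace GenusTwoCurve

variable {C : GenusTwoCurve} {e : OpenPartialHomeomorph C.Pt ℂ}

open Filter Topology Laplacian

open Classical in
/-- The order of vanishing at `Q` of the function `F_R`. -/
def orderF (R Q : C.Pt) : ℕ := (if Q = R then 1 else 0) + (if Q = C.involution R then 1 else 0)

theorem involution_mem_weierstrassPoints (R : C.Pt) :
    C.involution R ∈ C.weierstrassPoints ↔ R ∈ C.weierstrassPoints := by
  rw [← C.involution_eq_self_iff, ← C.involution_eq_self_iff, C.involution_involution, eq_comm]

theorem orderF_eq_zero {R Q : C.Pt} (h : C.F R Q ≠ 0) : orderF R Q = 0 := by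
  rw [Ne, C.F_eq_zero_iff, not_or] at h
  simp [orderF, h.1, h.2]

/-- At a Weierstrass point `Q = R = ι R`, so both indicators count; this matches the ramification of
`x`. -/
theorem orderF_eq_two {R Q : C.Pt} (h : C.F R Q = 0) (hQ : Q ∈ C.weierstrassPoints) :
    orderF R Q = 2 := by
  rw [C.F_eq_zero_iff] at h
  have hR : R ∈ C.weierstrassPoints := by
    rcases h with rfl | rfl
    · exact hQ
    · exact (involution_mem_weierstrassPoints R).1 hQ
  have hi := (C.involution_eq_self_iff R).2 hR
  rw [hi, or_self] at h
  simp [orderF, hi, h]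

theorem orderF_eq_one {R Q : C.Pt} (h : C.F R Q = 0) (hQ : Q ∉ C.weierstrassPoints) :
    orderF R Q = 1 := by
  rw [C.F_eq_zero_iff] at h
  have hR : R ∉ C.weierstrassPoints := by
    rcases h with rfl | rfl
    · exact hQ
    · exact (involution_mem_weierstrassPoints R).not.1 hQ
  have hi : C.involution R ≠ R := (C.involution_eq_self_iff R).not.2 hR
  rcases h with rfl | rfl
  · simp [orderF, hi.symm]
  · simp [orderF, hi]

/-- The linear function of the affine coordinate that represents `F_R` factors at every point with
exponent the order of vanishing. -/
theorem LocalModel.exists_factorization {p : ℂ[X]} {a b : ℂ → ℂ} (h : C.LocalModel e p a b)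
    {R : C.Pt} {l m : ℂ} (hlm : l ≠ 0 ∨ m ≠ 0)
    (hF : ∀ t ∈ e.target, C.F R (e.symm t) = ‖l * a t + m‖ / √(1 + ‖a t‖ ^ 2))
    {t₀ : ℂ} (ht₀ : t₀ ∈ e.target) :
    ∃ g : ℂ → ℂ, AnalyticAt ℂ g t₀ ∧ g t₀ ≠ 0 ∧
      ∀ᶠ t in 𝓝 t₀, l * a t + m = (t - t₀) ^ orderF R (e.symm t₀) * g t := by
  have ha := h.analyticAt_fst t₀ ht₀
  have hb := h.analyticAt_snd t₀ ht₀
  have hk : AnalyticAt ℂ (fun t => l * a t + m) t₀ := (analyticAt_const.mul ha).add analyticAt_const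
  have hFk : C.F R (e.symm t₀) = 0 ↔ l * a t₀ + m = 0 := by
    rw [hF t₀ ht₀, div_eq_zero_iff, or_iff_left (by positivity), norm_eq_zero]
  by_cases h0 : l * a t₀ + m = 0
  · have hl : l ≠ 0 := by
      rintro rfl
      rw [zero_mul, zero_add] at h0
      simp [h0] at hlm
    by_cases hbt : b t₀ = 0
    · rw [orderF_eq_two (hFk.2 h0) ((h.weierstrass_iff t₀ ht₀).2 hbt)]
      obtain ⟨β, hβ, hβ0, hβe⟩ := hb.exists_eq_sub_mul hbt
      have hroot : p.eval (a t₀) = 0 := by rw [← h.eqn t₀ ht₀, hbt]; simp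
      -- With `p = (X - a t₀) q`, where `q (a t₀) ≠ 0` as the root is simple, the equation `b² =
      -- p(a)` gives `a - a t₀ = b² / q(a)`. Since `b = (t - t₀) β`, the function `l a + m = l (a -
      -- a t₀)` has a double zero with cofactor `l β² / q(a)`.
      obtain ⟨q, hq⟩ := dvd_iff_isRoot.2 hroot
      have hq0 : q.eval (a t₀) ≠ 0 := by
        have := h.nonsingular _ hroot
        rw [hq] at this
        simpa using this
      have hqa : AnalyticAt ℂ (fun t => q.eval (a t)) t₀ := by
        simpa using ha.aeval_polynomial q
      refine ⟨fun t => l * β t ^ 2 / q.eval (a t), (analyticAt_const.mul (hβ.pow 2)).div hqa hq0,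
        ?_, ?_⟩
      · refine div_ne_zero (mul_ne_zero hl (pow_ne_zero _ ?_)) hq0
        rw [hβ0]
        exact h.deriv_snd_ne_zero ht₀ hbt
      · filter_upwards [e.open_target.mem_nhds ht₀, hqa.continuousAt.eventually_ne hq0] with t ht htq
        have h1 := h.eqn t ht
        rw [hq, hβe t, eval_mul, eval_sub, eval_X, eval_C] at h1
        field_simp
        linear_combination (-l) * h1 + q.eval (a t) * h0
    · rw [orderF_eq_one (hFk.2 h0) ((h.weierstrass_iff t₀ ht₀).not.2 hbt)]
      obtain ⟨g, hg, hg0, hge⟩ := hk.exists_eq_sub_mul h0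
      refine ⟨g, hg, ?_, .of_forall fun t => by rw [pow_one]; exact hge t⟩
      -- Away from the branch points `a' ≠ 0`, so the zero is simple with cofactor `l a'` at `t₀`.
      rw [hg0, deriv_add_const, deriv_const_mul _ ha.differentiableAt]
      exact mul_ne_zero hl ((h.deriv_fst_eq_zero_iff ht₀).not.2 hbt)
  · rw [orderF_eq_zero (hFk.not.2 h0)]
    exact ⟨_, hk, h0, .of_forall fun t => by simp⟩

/-- Near every point, `log F_R` is a multiple of `log |t - t₀|` plus a smooth function whose
Laplacian is the multiple `-2` of the density of the branch divisor. -/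
theorem exists_log_F_eq (he : e ∈ C.charts) {P : Fin 6 → C.Pt} (hP : Function.Injective P)
    (hPW : range P = C.weierstrassPoints) (R : C.Pt) {t₀ : ℂ} (ht₀ : t₀ ∈ e.target) :
    ∃ V : Set ℂ, IsOpen V ∧ t₀ ∈ V ∧ V ⊆ e.target ∧ ∃ h : ℂ → ℝ, ContDiffOn ℝ ∞ h V ∧
      (∀ t ∈ V, t ≠ t₀ ∨ orderF R (e.symm t₀) = 0 → Real.log (C.F R (e.symm t)) =
        orderF R (e.symm t₀) * Real.log ‖t - t₀‖ + h t) ∧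
      ∀ t ∈ V, (Δ h) t = -2 * ((∏ i, C.F (P i) (e.symm t)) * C.conformalFactor e t) := by
  obtain ⟨p, a, b, M⟩ := C.exists_localModel he
  obtain ⟨l, m, hlm, hF⟩ := M.F_eq R
  obtain ⟨g, hg, hg0, hge⟩ := M.exists_factorization hlm hF ht₀
  obtain ⟨V, hV, hVo, htV⟩ := eventually_nhds_iff.1 ((((hg.eventually_analyticAt).and
    (hg.continuousAt.eventually_ne hg0)).and hge).and (e.open_target.mem_nhds ht₀))
  have hVt : V ⊆ e.target := fun t ht => (hV t ht).2
  have d1 : ∀ t ∈ V, ContDiffAt ℝ ∞ (fun s => Real.log ‖g s‖) t := fun t ht => by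
    obtain ⟨⟨⟨hgt, hgt0⟩, -⟩, -⟩ := hV t ht
    exact ((hgt.contDiffAt.restrict_scalars ℝ).norm ℝ hgt0).log (norm_ne_zero_iff.2 hgt0)
  have d2 : ∀ t ∈ V, ContDiffAt ℝ ∞ (fun s => Real.log (1 + ‖a s‖ ^ 2)) t := fun t ht =>
    (contDiff_log_add_norm_sq one_pos).contDiffAt.comp t
      ((M.analyticAt_fst t (hVt ht)).contDiffAt.restrict_scalars ℝ)
  -- The smooth part is `log |g| - ½ log (1 + |a|²)`: the first term is harmonic because `g` is
  -- analytic and nonvanishing, so only the spherical potential contributes to the Laplacian.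
  refine ⟨V, hVo, htV, hVt, (fun s => Real.log ‖g s‖) +
    (-(1 / 2) : ℝ) • fun s => Real.log (1 + ‖a s‖ ^ 2), fun t ht => ?_, fun t ht ht0 => ?_, fun t ht => ?_⟩
  · have := (d1 t ht).add ((d2 t ht).const_smul (-(1 / 2) : ℝ))
    exact this.contDiffWithinAt
  · obtain ⟨⟨⟨hgt, hgt0⟩, hgt1⟩, hte⟩ := hV t ht
    -- In order zero the power is `1` even at `t = t₀`, so the identity holds at the centre too;
    -- smoothness of `log F_R` off its zeros needs this.
    have hpow : ‖t - t₀‖ ^ orderF R (e.symm t₀) ≠ 0 := by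
      rcases ht0 with ht0 | ht0
      · exact pow_ne_zero _ (norm_ne_zero_iff.2 (sub_ne_zero.2 ht0))
      · simp [ht0]
    rw [hF t hte, hgt1, norm_mul, norm_pow,
      Real.log_div (mul_ne_zero hpow (norm_ne_zero_iff.2 hgt0)) (by positivity),
      Real.log_mul hpow (norm_ne_zero_iff.2 hgt0), Real.log_pow, Real.log_sqrt (by positivity)]
    simp only [Pi.add_apply, Pi.smul_apply, smul_eq_mul]
    ring
  · obtain ⟨⟨⟨hgt, hgt0⟩, -⟩, -⟩ := hV t ht
    have c1 := (d1 t ht).of_le (m := 2) (by norm_cast)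
    have c2 := (d2 t ht).of_le (m := 2) (by norm_cast)
    have c3 : ContDiffAt ℝ 2 ((-(1 / 2) : ℝ) • fun s => Real.log (1 + ‖a s‖ ^ 2)) t :=
      c2.const_smul (-(1 / 2) : ℝ)
    rw [c1.laplacian_add c3, InnerProductSpace.laplacian_smul _ c2,
      (hgt.harmonicAt_log_norm hgt0).2.eq_of_nhds,
      laplacian_log_one_add_norm_sq_comp (M.analyticAt_fst t (hVt ht)),
      M.prod_F_mul_conformalFactor hP hPW (hVt ht)]
    simp
    ring

theorem continuous_F (R : C.Pt) : Continuous (C.F R) := by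
  rw [continuous_iff_continuousAt]
  intro Q
  obtain ⟨e, he, hQ⟩ := C.exists_chart Q
  obtain ⟨p, a, b, M⟩ := C.exists_localModel he
  obtain ⟨l, m, -, hF⟩ := M.F_eq R
  have ht := e.map_source hQ
  refine continuousAt_of_comp_symm hQ ?_
  have ca := (M.analyticAt_fst _ ht).continuousAt
  have : ContinuousAt (fun t => ‖l * a t + m‖ / √(1 + ‖a t‖ ^ 2)) (e Q) :=
    ((continuousAt_const.mul ca).add continuousAt_const).norm.div
      (continuousAt_const.add (ca.norm.pow 2)).sqrt (by positivity)
  refine this.congr ?_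
  filter_upwards [e.open_target.mem_nhds ht] with t ht using (hF t ht).symm

theorem measurable_log_F (R : C.Pt) : Measurable fun Q => Real.log (C.F R Q) :=
  Real.measurable_log.comp (continuous_F R).measurable

theorem contMDiffAt_log_F {P : Fin 6 → C.Pt} (hP : Function.Injective P)
    (hPW : range P = C.weierstrassPoints) {R Q : C.Pt} (h : C.F R Q ≠ 0) :
    ContMDiffAt 𝓘(ℝ, ℂ) 𝓘(ℝ, ℝ) ∞ (fun Q => Real.log (C.F R Q)) Q := by
  obtain ⟨e, he, hQ⟩ := C.exists_chart Q
  obtain ⟨V, hVo, htV, hVt, k, hk, hlog, -⟩ := exists_log_F_eq he hP hPW R (e.map_source hQ)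
  rw [e.left_inv hQ, orderF_eq_zero h] at hlog
  refine contMDiffAt_of_comp_symm he hQ ?_
  refine (hk.contDiffAt (hVo.mem_nhds htV)).congr_of_eventuallyEq ?_
  filter_upwards [hVo.mem_nhds htV] with t ht
  simpa using hlog t ht (Or.inr rfl)

theorem integrable_log_F {P : Fin 6 → C.Pt} (hP : Function.Injective P)
    (hPW : range P = C.weierstrassPoints) (R : C.Pt) : Integrable (fun Q => Real.log (C.F R Q)) C.area := by
  refine integrable_of_charts (measurable_log_F R) fun Q => ?_
  obtain ⟨e, he, hQ⟩ := C.exists_chart Q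
  obtain ⟨V, hVo, htV, hVt, k, hk, hlog, -⟩ := exists_log_F_eq he hP hPW R (e.map_source hQ)
  refine ⟨e, he, hQ, ?_⟩
  obtain ⟨K, hK, hKV, hKc⟩ := local_compact_nhds (hVo.mem_nhds htV)
  refine ⟨K, hK, ?_⟩
  have h1 : IntegrableOn (fun t => orderF R (e.symm (e Q)) * Real.log ‖t - e Q‖ + k t) K :=
    (((locallyIntegrable_log_norm_sub (e Q)).integrableOn_isCompact hKc).const_mul _).add
      ((hk.continuousOn.mono hKV).integrableOn_compact hKc)
  refine Integrable.congr h1 ?_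
  have h0 : ∀ᵐ t : ℂ ∂volume.restrict K, t ≠ e Q := ae_restrict_of_ae (by simp [ae_iff])
  filter_upwards [h0, ae_restrict_mem₀ hKc.measurableSet.nullMeasurableSet] with t ht htK
  exact (hlog t (hKV htK) (Or.inl ht)).symm

/-- The distributional equation of `log F_R`, tested with functions supported near a point. -/
theorem exists_nhds_integral_log_F_mul_laplacian {P : Fin 6 → C.Pt} (hP : Function.Injective P)
    (hPW : range P = C.weierstrassPoints) (R Q : C.Pt) :
    ∃ U : Set C.Pt, IsOpen U ∧ Q ∈ U ∧ ∀ φ : C.Pt → ℝ, ContMDiff 𝓘(ℝ, ℂ) 𝓘(ℝ, ℝ) ∞ φ →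
      tsupport φ ⊆ U → ∫ S, Real.log (C.F R S) * C.laplacian φ S ∂C.area =
        2 * Real.pi * (φ R + φ (C.involution R)) -
          2 * ∫ S, (∏ i, C.F (P i) S) * φ S ∂C.area := by
  classical
  obtain ⟨e, he, hQ⟩ := C.exists_chart Q
  obtain ⟨V, hVo, htV, hVt, k, hk, hlog, hlap⟩ := exists_log_F_eq he hP hPW R (e.map_source hQ)
  rw [e.left_inv hQ] at hlog
  -- The neighbourhood omits `R` and `ι R` unless they equal `Q`, so that only the singularity at
  -- the centre `Q` meets the support of `φ`.
  refine ⟨(e.source ∩ e ⁻¹' V) \ ({R, C.involution R} \ {Q}),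
    (e.isOpen_inter_preimage hVo).sdiff (((Set.finite_singleton _).insert _).sdiff).isClosed,
    ⟨⟨hQ, htV⟩, by simp⟩, fun φ hφ hφU => ?_⟩
  have hφV : tsupport φ ⊆ e.source ∩ e ⁻¹' V := hφU.trans sdiff_subset
  have hφs : tsupport φ ⊆ e.source := hφV.trans inter_subset_left
  have hval : ∀ S, S = R ∨ S = C.involution R → φ S = (if Q = S then 1 else 0) * φ Q := by
    intro S hS
    split_ifs with h
    · rw [h, one_mul]
    · rw [zero_mul]
      refine image_eq_zero_of_notMem_tsupport fun h' => (hφU h').2 ⟨hS, ?_⟩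
      exact fun h'' => h (mem_singleton_iff.1 h'').symm
  -- The two Dirac masses become the order of vanishing at `Q`, including the case `R = ι R = Q` of
  -- order two.
  have hord : φ R + φ (C.involution R) = orderF R Q * φ Q := by
    rw [hval R (Or.inl rfl), hval _ (Or.inr rfl), orderF]
    push_cast
    ring
  -- Outside `e.target` the values of `e.symm` are meaningless. Extension by zero is smooth because
  -- `e` carries the support of `φ` to a compact subset of `V`.
  set ψ : ℂ → ℝ := e.target.indicator fun t => φ (e.symm t) with hψ
  have hK : IsCompact (e '' tsupport φ) :=
    (isClosed_tsupport φ).isCompact.image_of_continuousOn (e.continuousOn.mono hφs)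
  have hKV : e '' tsupport φ ⊆ V := by
    rintro _ ⟨S, hS, rfl⟩
    exact (hφV hS).2
  have hψ0 : ∀ t ∉ e '' tsupport φ, ψ t = 0 := by
    intro t ht
    rw [hψ, indicator_apply]
    split_ifs with h
    · exact image_eq_zero_of_notMem_tsupport fun h' => ht ⟨_, h', e.right_inv h⟩
    · rfl
  have hψe : ∀ t ∈ e.target, ψ =ᶠ[𝓝 t] fun t => φ (e.symm t) := by
    intro t ht
    filter_upwards [e.open_target.mem_nhds ht] with s hs using indicator_of_mem hs _
  have hψK : tsupport ψ ⊆ e '' tsupport φ :=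
    closure_minimal (fun t ht => by_contra fun h => ht (hψ0 t h)) hK.isClosed
  have hψc : HasCompactSupport ψ := hK.of_isClosed_subset (isClosed_tsupport ψ) hψK
  have hψd : ContDiff ℝ ∞ ψ := by
    rw [contDiff_iff_contDiffAt]
    intro t
    by_cases ht : t ∈ e.target
    · exact ((contDiffOn_comp_symm hφ he).contDiffAt
        (e.open_target.mem_nhds ht)).congr_of_eventuallyEq (hψe t ht)
    · have h1 : t ∉ tsupport ψ := fun h => ht (hVt (hKV (hψK h)))
      exact contDiffAt_const.congr_of_eventuallyEq (notMem_tsupport_iff_eventuallyEq.1 h1)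
  have hmain := integral_log_add_mul_laplacian (u := fun t => Real.log (C.F R (e.symm t))) hVo hk
    (fun t ht ht0 => hlog t ht (Or.inl ht0)) hψd hψc (hψK.trans hKV)
  have hψQ : ψ (e Q) = φ Q := by
    rw [hψ, indicator_of_mem (e.map_source hQ), e.left_inv hQ]
  have hlap0 : ∀ S ∉ e.source, C.laplacian φ S = 0 := by
    intro S hS
    have h1 : φ =ᶠ[𝓝 S] fun _ => 0 :=
      notMem_tsupport_iff_eventuallyEq.1 fun h => hS (hφs h)
    have hS' := mem_chart_source ℂ S
    have h2 : (fun t => φ ((chartAt ℂ S).symm t)) =ᶠ[𝓝 (chartAt ℂ S S)] fun _ => 0 := by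
      rw [← (chartAt ℂ S).left_inv hS'] at h1
      exact ((chartAt ℂ S).symm.continuousAt ((chartAt ℂ S).map_source hS')).eventually h1
    rw [laplacian, (InnerProductSpace.laplacian_congr_nhds h2).eq_of_nhds]
    simp
  have hL : ∫ S, Real.log (C.F R S) * C.laplacian φ S ∂C.area =
      ∫ t, Real.log (C.F R (e.symm t)) * (Δ ψ) t := by
    have hz : ∀ t ∉ e.target, Real.log (C.F R (e.symm t)) * (Δ ψ) t = 0 := fun t ht => by
      rw [image_eq_zero_of_notMem_tsupport fun h =>
        ht (hVt (hKV (hψK (tsupport_laplacian_subset ψ h)))), mul_zero]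
    rw [← setIntegral_eq_integral_of_forall_compl_eq_zero (s := e.source)
        fun S hS => by rw [hlap0 S hS, mul_zero],
      setIntegral_source he (G := fun S => Real.log (C.F R S) * C.laplacian φ S)
        ((measurable_log_F R).mul (continuous_laplacian hφ).measurable),
      ← setIntegral_eq_integral_of_forall_compl_eq_zero hz]
    refine setIntegral_congr_fun e.open_target.measurableSet fun t ht => ?_
    -- The density `ρ` of the area cancels the `ρ⁻¹` of the Laplace-Beltrami operator, leaving the
    -- plane Laplacian of `ψ`.
    have := (conformalFactor_pos he ht).ne'
    simp only [laplacian_eq hφ he ht,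
      (InnerProductSpace.laplacian_congr_nhds (hψe t ht)).eq_of_nhds]
    field_simp
  have hRr : ∫ t, (Δ k) t * ψ t = -2 * ∫ S, (∏ i, C.F (P i) S) * φ S ∂C.area := by
    rw [← setIntegral_eq_integral_of_forall_compl_eq_zero (s := e.source) (μ := C.area)
        fun S hS => by rw [image_eq_zero_of_notMem_tsupport fun h => hS (hφs h), mul_zero],
      setIntegral_source he (G := fun S => (∏ i, C.F (P i) S) * φ S) (Measurable.mul
        (Finset.measurable_fun_prod _ fun i _ => (continuous_F (P i)).measurable)
        hφ.continuous.measurable),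
      ← setIntegral_eq_integral_of_forall_compl_eq_zero (s := e.target)
        fun t ht => by rw [hψ, indicator_of_notMem ht, mul_zero], ← integral_const_mul]
    refine setIntegral_congr_fun e.open_target.measurableSet fun t ht => ?_
    by_cases htK : t ∈ V
    · simp only [hlap t htK, (hψe t ht).eq_of_nhds]
      ring
    · have h0 : ψ t = 0 := hψ0 t fun h => htK (hKV h)
      have h1 : φ (e.symm t) = 0 := by rw [← (hψe t ht).eq_of_nhds, h0]
      simp [h0, h1]
  rw [hL, hmain, hRr, hψQ, hord]
  ring

/-- The function `log F_R` satisfies `Δ log F_R = 2π (δ_R + δ_{ι R}) - 2 ∏ F_{P_i}` in the sense of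
distributions. -/
theorem integral_log_F_mul_laplacian {P : Fin 6 → C.Pt} (hP : Function.Injective P)
    (hPW : range P = C.weierstrassPoints) (R : C.Pt) {φ : C.Pt → ℝ}
    (hφ : ContMDiff 𝓘(ℝ, ℂ) 𝓘(ℝ, ℝ) ∞ φ) :
    ∫ S, Real.log (C.F R S) * C.laplacian φ S ∂C.area =
      2 * Real.pi * (φ R + φ (C.involution R)) - 2 * ∫ S, (∏ i, C.F (P i) S) * φ S ∂C.area := by
  choose U hUo hQU hU using exists_nhds_integral_log_F_mul_laplacian hP hPW R
  obtain ⟨s, hs⟩ := isCompact_univ.elim_nhds_subcover U fun Q _ => (hUo Q).mem_nhds (hQU Q)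
  -- Both sides are linear in `φ`, so a partition of unity subordinate to a finite cover by the
  -- neighbourhoods of the local statement reduces to `φ` supported in one of them.
  obtain ⟨f, hf⟩ := SmoothPartitionOfUnity.exists_isSubordinate 𝓘(ℝ, ℂ) (isClosed_univ (X := C.Pt))
    (fun i : s => U i) (fun i => hUo i) (by simpa [iUnion_subtype] using hs.2)
  have hsum : ∀ S, ∑ i : s, f i S = 1 := fun S => by
    rw [← finsum_eq_sum_of_fintype]
    exact f.sum_eq_one (mem_univ S)
  have hfφ : ∀ i, ContMDiff 𝓘(ℝ, ℂ) 𝓘(ℝ, ℝ) ∞ fun S => f i S * φ S := fun i =>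
    (f i).contMDiff.mul hφ
  have hφsum : ∀ S, φ S = ∑ i : s, f i S * φ S := fun S => by
    rw [← Finset.sum_mul, hsum, one_mul]
  have hlap : ∀ S, C.laplacian φ S = ∑ i : s, C.laplacian (fun S => f i S * φ S) S := fun S => by
    rw [← laplacian_sum _ fun i _ => hfφ i]
    exact congrArg (fun φ => C.laplacian φ S) (funext hφsum)
  have hi1 : ∀ i, Integrable (fun S => Real.log (C.F R S) *
      C.laplacian (fun S => f i S * φ S) S) C.area := by
    intro i
    have hc := continuous_laplacian (hfφ i)
    obtain ⟨M, hM⟩ := isCompact_univ.exists_bound_of_continuousOn hc.continuousOn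
    exact (integrable_log_F hP hPW R).mul_bdd (c := M) hc.aestronglyMeasurable
      (.of_forall fun S => hM S (mem_univ S))
  have hi2 : ∀ i, Integrable (fun S => (∏ i, C.F (P i) S) * (f i S * φ S)) C.area := fun i =>
    integrable_of_continuous ((continuous_finsetProd _ fun i _ => continuous_F (P i)).mul
      (hfφ i).continuous)
  have e1 : ∫ S, Real.log (C.F R S) * C.laplacian φ S ∂C.area =
      ∑ i : s, ∫ S, Real.log (C.F R S) * C.laplacian (fun S => f i S * φ S) S ∂C.area := by
    rw [← integral_finsetSum _ fun i _ => hi1 i]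
    simp only [hlap, Finset.mul_sum]
  have e2 : ∫ S, (∏ i, C.F (P i) S) * φ S ∂C.area =
      ∑ i : s, ∫ S, (∏ i, C.F (P i) S) * (f i S * φ S) ∂C.area := by
    rw [← integral_finsetSum _ fun i _ => hi2 i]
    simp only [← Finset.mul_sum, ← hφsum]
  have e3 : ∀ i : s, ∫ S, Real.log (C.F R S) * C.laplacian (fun S => f i S * φ S) S ∂C.area =
      2 * Real.pi * (f i R * φ R + f i (C.involution R) * φ (C.involution R)) -
        2 * ∫ S, (∏ i, C.F (P i) S) * (f i S * φ S) ∂C.area := fun i =>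
    hU i _ (hfφ i) ((tsupport_mul_subset_left).trans (hf i))
  rw [e1, e2, Finset.sum_congr rfl fun i _ => e3 i, Finset.sum_sub_distrib, ← Finset.mul_sum,
    ← Finset.mul_sum, Finset.sum_add_distrib, ← hφsum, ← hφsum]

end GenusTwoCurve

/-! ### Divisors and the main theorem -/

namespace GenusTwoCurve

variable {C : GenusTwoCurve}

open Filter Topology

/-- The logarithm of `F_E` at `R`, as an additive function of the divisor `E`. -/
def logFD (R : C.Pt) : C.Divisor →+ ℝ :=
  Finsupp.liftAddHom fun S => (AddMonoidHom.mulRight (Real.log (C.F S R))).comp (Int.castAddHom ℝ)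

theorem logFD_single (R S : C.Pt) (n : ℤ) :
    logFD R (Finsupp.single S n) = n * Real.log (C.F S R) := by
  simp [logFD]

/-- Away from the zeros of its factors, `F_E` turns sums of divisors into products. The zeros must
be avoided, since `Real.log 0 = 0` would give `exp 0 = 1` there. -/
theorem FD_eq_exp {E : C.Divisor} {R : C.Pt} (h : ∀ S ∈ E.support, C.F S R ≠ 0) :
    C.FD E R = Real.exp (logFD R E) := by
  rw [FD, logFD, Finsupp.liftAddHom_apply, Finsupp.sum, Real.exp_sum, Finsupp.prod]
  refine Finset.prod_congr rfl fun S hS => ?_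
  have : 0 < C.F S R := lt_of_le_of_ne (C.F_nonneg S R) (h S hS).symm
  simp [← Real.rpow_intCast, Real.rpow_def_of_pos this, mul_comm]

end GenusTwoCurve

end

theorem theorem1p2 (C : GenusTwoCurve)
    (P : Fin 6 → C.Pt) (hP : Function.Injective P) (hPW : Set.range P = C.weierstrassPoints)
    (s : ℕ) (Q : Fin s → C.Pt) (hQ : Function.Injective Q) (hQP : ∀ i j, P i ≠ Q j)
    (m : Fin s → ℕ) (hm : ∀ j, 0 < m j)
    (W D : C.Divisor) (hW : W = ∑ i, Finsupp.single (P i) 1)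
    (hD : D = ∑ j, Finsupp.single (Q j) (m j : ℤ)) :
    ∃ v : C.Pt → ℝ,
      (∀ R ∉ Set.range P ∪ Set.range Q ∪ Set.range (fun j => C.involution (Q j)),
        v R = Real.log (C.FD (W - D) R)) ∧
      ContMDiffOn 𝓘(ℝ, ℂ) 𝓘(ℝ, ℝ) ∞ v
        (Set.range P ∪ Set.range Q ∪ Set.range (fun j => C.involution (Q j)))ᶜ ∧
      C.IsSolution (2 * (6 - ∑ j, (m j : ℝ))) (C.FD D)
        ((4 * Real.pi) • ∑ i, C.dirac (P i) -
          (2 * Real.pi) • ∑ j, (m j : ℝ) • (C.dirac (Q j) + C.dirac (C.involution (Q j)))) v := by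
  classical
  set B : Set C.Pt :=
    Set.range P ∪ Set.range Q ∪ Set.range (fun j => C.involution (Q j)) with hB
  have hBf : B.Finite :=
    ((Set.finite_range _).union (Set.finite_range _)).union (Set.finite_range _)
  have hBae : ∀ᵐ R ∂C.area, R ∉ B := by
    rw [MeasureTheory.ae_iff]
    simpa using hBf.measure_zero C.area
  have hiP : ∀ i, C.involution (P i) = P i := fun i =>
    (C.involution_eq_self_iff _).2 (hPW ▸ ⟨i, rfl⟩)
  have hFP : ∀ R ∉ B, ∀ i, C.F (P i) R ≠ 0 := by
    intro R hR i h
    rw [C.F_eq_zero_iff, hiP, or_self] at h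
    exact hR (Or.inl (Or.inl ⟨i, h.symm⟩))
  have hFQ : ∀ R ∉ B, ∀ j, C.F (Q j) R ≠ 0 := by
    intro R hR j h
    rw [C.F_eq_zero_iff] at h
    rcases h with h | h
    · exact hR (Or.inl (Or.inr ⟨j, h.symm⟩))
    · exact hR (Or.inr ⟨j, h.symm⟩)
  have hWs : ∀ S ∈ W.support, ∃ i, P i = S := by
    intro S hS
    by_contra! h
    refine Finsupp.mem_support_iff.1 hS ?_
    simp [hW, h]
  have hDs : ∀ S ∈ D.support, ∃ j, Q j = S := by
    intro S hS
    by_contra! h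
    refine Finsupp.mem_support_iff.1 hS ?_
    simp [hD, h]
  have hD0 : ∀ R ∉ B, ∀ S ∈ D.support, C.F S R ≠ 0 := by
    intro R hR S hS
    obtain ⟨j, rfl⟩ := hDs S hS
    exact hFQ R hR j
  have hWD0 : ∀ R ∉ B, ∀ S ∈ (W - D).support, C.F S R ≠ 0 := by
    intro R hR S hS
    rcases Finset.mem_union.1 (Finsupp.support_sub hS) with h | h
    · obtain ⟨i, rfl⟩ := hWs S h
      exact hFP R hR i
    · exact hD0 R hR S h
  have hlogW : ∀ R, GenusTwoCurve.logFD R W = ∑ i, Real.log (C.F (P i) R) := fun R => by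
    simp [hW, GenusTwoCurve.logFD_single]
  have hlogD : ∀ R, GenusTwoCurve.logFD R D = ∑ j, m j * Real.log (C.F (Q j) R) := fun R => by
    simp [hD, GenusTwoCurve.logFD_single]
  have hv : ∀ R ∉ B, Real.log (C.FD (W - D) R) =
      ∑ i, Real.log (C.F (P i) R) - ∑ j, m j * Real.log (C.F (Q j) R) := by
    intro R hR
    rw [GenusTwoCurve.FD_eq_exp (hWD0 R hR), Real.log_exp, map_sub, hlogW, hlogD]
  -- This is `F_D F_{W-D} = F_W`: the nonlinear term equals, off a finite set, the density common to
  -- all the linear equations for `log F_R`.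
  have hDv : ∀ R ∉ B, C.FD D R * Real.exp (Real.log (C.FD (W - D) R)) = ∏ i, C.F (P i) R := by
    intro R hR
    rw [GenusTwoCurve.FD_eq_exp (hWD0 R hR), Real.log_exp, GenusTwoCurve.FD_eq_exp (hD0 R hR),
      ← Real.exp_add, map_sub, add_sub_cancel, hlogW, Real.exp_sum]
    exact Finset.prod_congr rfl fun i _ =>
      Real.exp_log (lt_of_le_of_ne (C.F_nonneg _ _) (hFP R hR i).symm)
  have hiP' := fun i => GenusTwoCurve.integrable_log_F hP hPW (P i)
  have hiQ' := fun j => (GenusTwoCurve.integrable_log_F hP hPW (Q j)).const_mul (m j : ℝ)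
  have hFW : Continuous fun R => ∏ i, C.F (P i) R :=
    continuous_finsetProd _ fun i _ => GenusTwoCurve.continuous_F (P i)
  have hvae : (fun R => Real.log (C.FD (W - D) R)) =ᵐ[C.area] fun R =>
      ∑ i, Real.log (C.F (P i) R) - ∑ j, m j * Real.log (C.F (Q j) R) := by
    filter_upwards [hBae] with R hR using hv R hR
  have hDae : (fun R => C.FD D R * Real.exp (Real.log (C.FD (W - D) R))) =ᵐ[C.area]
      fun R => ∏ i, C.F (P i) R := by
    filter_upwards [hBae] with R hR using hDv R hR
  -- On the finite set `B` this function takes default values, which are harmless because points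
  -- have area zero.
  refine ⟨fun R => Real.log (C.FD (W - D) R), fun R _ => rfl, ?_, ?_, ?_, fun φ hφ => ?_⟩
  · intro R hR
    have h1 : ContMDiffAt 𝓘(ℝ, ℂ) 𝓘(ℝ, ℝ) ∞ (fun R =>
        ∑ i, Real.log (C.F (P i) R) - ∑ j, m j * Real.log (C.F (Q j) R)) R := by
      refine ContMDiffAt.sub ?_ ?_
      · exact contMDiffAt_finsetSum fun i _ =>
          GenusTwoCurve.contMDiffAt_log_F hP hPW (hFP R hR i)
      · exact contMDiffAt_finsetSum fun j _ =>
          contMDiffAt_const.mul (GenusTwoCurve.contMDiffAt_log_F hP hPW (hFQ R hR j))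
    refine (h1.congr_of_eventuallyEq ?_).contMDiffWithinAt
    filter_upwards [hBf.isClosed.isOpen_compl.mem_nhds hR] with S hS using hv S hS
  · exact ((MeasureTheory.integrable_finsetSum _ fun i _ => hiP' i).sub
      (MeasureTheory.integrable_finsetSum _ fun j _ => hiQ' j)).congr hvae.symm
  · exact (GenusTwoCurve.integrable_of_continuous hFW).congr hDae.symm
  · have hc := GenusTwoCurve.continuous_laplacian hφ
    obtain ⟨M, hM⟩ := isCompact_univ.exists_bound_of_continuousOn hc.continuousOn
    have hi : ∀ R, MeasureTheory.Integrable
        (fun S => Real.log (C.F R S) * C.laplacian φ S) C.area := fun R =>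
      (GenusTwoCurve.integrable_log_F hP hPW R).mul_bdd (c := M) hc.aestronglyMeasurable
        (.of_forall fun S => hM S (Set.mem_univ S))
    have e1 : ∫ S, Real.log (C.FD (W - D) S) * C.laplacian φ S ∂C.area =
        ∑ i, ∫ S, Real.log (C.F (P i) S) * C.laplacian φ S ∂C.area -
          ∑ j, m j * ∫ S, Real.log (C.F (Q j) S) * C.laplacian φ S ∂C.area := by
      simp only [← MeasureTheory.integral_const_mul]
      rw [← MeasureTheory.integral_finsetSum _ fun i _ => hi (P i),
        ← MeasureTheory.integral_finsetSum _ fun j _ => (hi (Q j)).const_mul (m j : ℝ),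
        ← MeasureTheory.integral_sub (MeasureTheory.integrable_finsetSum _ fun i _ => hi (P i))
          (MeasureTheory.integrable_finsetSum _ fun j _ => (hi (Q j)).const_mul (m j : ℝ))]
      refine MeasureTheory.integral_congr_ae ?_
      filter_upwards [hvae] with S hS
      simp only [hS, sub_mul, Finset.sum_mul, mul_assoc]
    have e2 : ∫ S, C.FD D S * Real.exp (Real.log (C.FD (W - D) S)) * φ S ∂C.area =
        ∫ S, (∏ i, C.F (P i) S) * φ S ∂C.area := by
      refine MeasureTheory.integral_congr_ae ?_
      filter_upwards [hDae] with S hS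
      rw [hS]
    simp only [e1, e2, GenusTwoCurve.integral_log_F_mul_laplacian hP hPW _ hφ, hiP]
    generalize ∫ S, (∏ i, C.F (P i) S) * φ S ∂C.area = I
    -- Each `P i` is its own conjugate, hence `4π`; the six of them contribute `-12 I` and the `Q j`
    -- contribute `+2 (∑ m_j) I`, which together cancel the nonlinear term `2 (6 - ∑ m_j) I`.
    have s1 : ∑ i, (2 * Real.pi * (φ (P i) + φ (P i)) - 2 * I) =
        4 * Real.pi * ∑ i, φ (P i) - 12 * I := by
      rw [Finset.sum_sub_distrib, Finset.mul_sum, Finset.sum_const, Finset.card_univ,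
        Fintype.card_fin, nsmul_eq_mul]
      congr 1
      · exact Finset.sum_congr rfl fun i _ => by ring
      · push_cast; ring
    have s2 : ∑ j, (m j : ℝ) * (2 * Real.pi * (φ (Q j) + φ (C.involution (Q j))) - 2 * I) =
        2 * Real.pi * ∑ j, (m j : ℝ) * (φ (Q j) + φ (C.involution (Q j))) -
          2 * (∑ j, (m j : ℝ)) * I := by
      rw [Finset.mul_sum, Finset.mul_sum, Finset.sum_mul, ← Finset.sum_sub_distrib]
      exact Finset.sum_congr rfl fun j _ => by ring
    rw [s1, s2]
    simp only [Pi.sub_apply, Pi.smul_apply, Pi.add_apply, Finset.sum_apply, smul_eq_mul,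
      GenusTwoCurve.dirac]
    ring
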